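/- Let $1\le k\le n$, let $\sigma$ be a permutation of $\{1,\dots,n\}$ that is increasing on $\{1,\dots,k\}$ and on $\{k+1,\dots,n\}$, and let $\omega_1,\dots,\omega_n\in\mathbb R$ be such that $\omega_{\sigma(1)},\dots,\omega_{\sigma(k)}$ are linearly independent over $\mathbb Q$ (non-resonance). Let $C=(c_1,\dots,c_n)\in\mathbb R^n$ satisfy $c_{\sigma(i)}>0$ for $i\le k$, $\sum_{i\le k}c_{\sigma(i)}^2=1$, and $c_{\sigma(i)}=0$ for $i>k$. On $\mathbb R^{2n}$, with coordinates $(x_i,y_i)$ and polar coordinates $(\rho_i,\theta_i)$ in the $i$-th plane, consider $$\Theta+v=\sum_{i=1}^n(\omega_i+f_i)\Big(x_i\tfrac{\partial}{\partial y_i}-y_i\tfrac{\partial}{\partial x_i}\Big)+g\sum_{i=1}^n\Big(x_i\tfrac{\partial}{\partial x_i}+y_i\tfrac{\partial}{\partial y_i}\Big),$$ where $g=\sum a_{\alpha,\beta}x^\alpha y^\beta$ and $f_i=\sum b^i_{\alpha,\beta}x^\alpha y^\beta$ are real formal power series without constant term. The leaf $\mathcal M^C_{k,\sigma}\cong\mathbb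 T_k\times\mathbb R^+$ is given by $\rho_{\sigma(j)}=\frac{c_{\sigma(j)}}{c_{\sigma(k)}}\rho_{\sigma(k)}>0$ for $j\le k$ and $\rho_{\sigma(j)}=0$ for $j>k$; it has coordinates $\rho_{\sigma(k)}>0$ and $\hat\theta=(\theta_{\sigma(1)},\dots,\theta_{\sigma(k)})$. On it, $\Theta+v$ reduces to the leaf vector field $$\Theta_k+v_{\sigma,C}=\sum_{j=1}^k\omega_{\sigma(j)}\frac{\partial}{\partial\theta_{\sigma(j)}}+\sum_{|\hat\alpha|+|\hat\beta|\ge1}\rho_{\sigma(k)}^{|\hat\alpha|+|\hat\beta|}\cos^{\hat\alpha}\hat\theta\,\sin^{\hat\beta}\hat\theta\Big(\tilde a_{\hat\alpha,\hat\beta}\sum_{j=1}^k\frac{c_{\sigma(j)}}{c_{\sigma(k)}}\rho_{\sigma(k)}\frac{\partial}{\partial\rho_{\sigma(j)}}+\sum_{j=1}^k\tilde b^{\,j}_{\hat\alpha,\hat\beta}\frac{\partial}{\partial\theta_{\sigma(j)}}\Big),$$ where $\hat\alpha,\hat\beta\in\mathbb Z_{\ge0}^k$, $$\tilde a_{\hat\alpha,\hat\beta}=\frac{\prod_{j=1}^kc_{\sigma(j)}^{\hat\alpha_j+\hat\beta_j}}{c_{\sigma(k)}^{|\hat\alpha|+|\hat\beta|}}\,a_{\alpha,\beta},\qquad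 \tilde b^{\,j}_{\hat\alpha,\hat\beta}=\frac{\prod_{i=1}^kc_{\sigma(i)}^{\hat\alpha_i+\hat\beta_i}}{c_{\sigma(k)}^{|\hat\alpha|+|\hat\beta|}}\,b^{\sigma(j)}_{\alpha,\beta},$$ and $\alpha,\beta$ are the multi-indices with $\alpha_{\sigma(j)}=\hat\alpha_j$, $\beta_{\sigma(j)}=\hat\beta_j$ for $j\le k$ and all other entries $0$. Then for each $p\ge0$ there are real polynomials $P_p$ and $P^i_p$ ($1\le i\le k$) in the variables $\tilde a_{\hat\alpha,\hat\beta},\tilde b^{\,j}_{\hat\alpha,\hat\beta}$ with $|\hat\alpha|+|\hat\beta|\le 2p$, depending only on $k,n,\sigma,\omega$ and $C$ (not on $f_i,g$), such that for all $f_i,g$ as above the following holds. Let $a_p$ and $b^i_p$ be the values of $P_p$ and $P^i_p$ at the reduced coefficients. Then $a_0=0$ and $b^i_0=\omega_{\sigma(i)}$, and there is a leaf-preserving formal near-identity change of the state variables $$\rho_{\sigma(j)}\mapsto(1+U)\rho_{\sigma(j)},\qquad \theta_{\sigma(j)}\mapsto\theta_{\sigma(j)}+Q_j\qquad(1\le j\le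 k),$$ where $U,Q_1,\dots,Q_k$ are restrictions to the leaf of real formal power series without constant term in $x_{\sigma(1)},y_{\sigma(1)},\dots,x_{\sigma(k)},y_{\sigma(k)}$, that transforms $\Theta_k+v_{\sigma,C}$ into the first level leaf normal form $$\sum_{p=0}^\infty\big(x_{\sigma(k)}^2+y_{\sigma(k)}^2\big)^p\,\mathbf A^\sigma_p\,(x_{\sigma(1)},y_{\sigma(1)},\dots,x_{\sigma(k)},y_{\sigma(k)})^t,$$ $$\mathbf A^\sigma_p=\mathrm{diag}(\mathbf A^\sigma_{1,p},\dots,\mathbf A^\sigma_{k,p}),\qquad \mathbf A^\sigma_{i,p}=\big(a_p^2+(b_p^i)^2\big)^{1/2}R_{\theta_p^i},$$ where $R_\theta$ is the counterclockwise rotation by $\theta$ and $\theta_p^i$ is the polar angle of the point $(a_p,b_p^i)$. -/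

import Mathlib

open scoped BigOperators

noncomputable section

namespace LeafNF

/-! ### Permutations, leaf parameters -/

/-- `S^k_n`: permutations that are increasing on the first `k` and on the last `n - k` indices. -/
def cellPerms (k n : ℕ) : Set (Equiv.Perm (Fin n)) :=
  {σ | (∀ i j : Fin n, i < j → (j : ℕ) < k → σ i < σ j) ∧
       (∀ i j : Fin n, i < j → k ≤ (i : ℕ) → σ i < σ j)}

/-- The `k` indices `σ(1), …, σ(k)` of the nonzero coordinate planes of the cell. -/
def cellIdx {k n : ℕ} (hkn : k ≤ n) (σ : Equiv.Perm (Fin n)) (j : Fin k) : Fin n :=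
  σ (Fin.castLE hkn j)

/-- The index `k` in `{1, …, k}`. -/
def lastIdx {k : ℕ} (hk : 0 < k) : Fin k := ⟨k - 1, Nat.sub_lt hk Nat.one_pos⟩

/-- `S^{k-1,σ}_{>0}`: vectors `c ∈ ℝⁿ` with `(c_{σ(1)}, …, c_{σ(k)})` a unit vector with positive
entries and `c_{σ(i)} = 0` for `i > k`. -/
def leafParams {k n : ℕ} (hkn : k ≤ n) (σ : Equiv.Perm (Fin n)) : Set (Fin n → ℝ) :=
  {c | (∑ j : Fin k, c (cellIdx hkn σ j) ^ 2 = 1) ∧ (∀ j : Fin k, 0 < c (cellIdx hkn σ j)) ∧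
       (∀ i : Fin n, k ≤ (i : ℕ) → c (σ i) = 0)}

/-! ### Formal functions on a leaf

A leaf is `T_k × ℝ⁺` with coordinates `θ = (θ_{σ(1)}, …, θ_{σ(k)})` and `ρ = ρ_{σ(k)}`; on it
`ρ_{σ(j)} = (c_{σ(j)} / c_{σ(k)}) ρ`.  Formal functions on the leaf are formal power series in `ρ`
whose coefficients are trigonometric polynomials in `θ`. -/

/-- Real trigonometric polynomials in `k` angles. -/
def TrigPoly (k : ℕ) : Subalgebra ℝ ((Fin k → ℝ) → ℝ) :=
  Algebra.adjoin ℝ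
    (Set.range (fun (j : Fin k) (θ : Fin k → ℝ) => Real.cos (θ j)) ∪
      Set.range (fun (j : Fin k) (θ : Fin k → ℝ) => Real.sin (θ j)))

/-- `cos θ_j`. -/
def cosT {k : ℕ} (j : Fin k) : TrigPoly k :=
  ⟨fun θ => Real.cos (θ j), Algebra.subset_adjoin (Or.inl ⟨j, rfl⟩)⟩

/-- `sin θ_j`. -/
def sinT {k : ℕ} (j : Fin k) : TrigPoly k :=
  ⟨fun θ => Real.sin (θ j), Algebra.subset_adjoin (Or.inr ⟨j, rfl⟩)⟩

lemma hasFDerivAt_cos {k : ℕ} (i : Fin k) (θ : Fin k → ℝ) :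
    HasFDerivAt (fun θ : Fin k → ℝ => Real.cos (θ i))
      (-Real.sin (θ i) • (ContinuousLinearMap.proj i : (Fin k → ℝ) →L[ℝ] ℝ)) θ :=
  (hasFDerivAt_apply (𝕜 := ℝ) i θ).cos

lemma hasFDerivAt_sin {k : ℕ} (i : Fin k) (θ : Fin k → ℝ) :
    HasFDerivAt (fun θ : Fin k → ℝ => Real.sin (θ i))
      (Real.cos (θ i) • (ContinuousLinearMap.proj i : (Fin k → ℝ) →L[ℝ] ℝ)) θ :=
  (hasFDerivAt_apply (𝕜 := ℝ) i θ).sin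

lemma differentiable_of_mem_trigPoly {k : ℕ} {t : (Fin k → ℝ) → ℝ} (ht : t ∈ TrigPoly k) :
    Differentiable ℝ t := by
  refine Algebra.adjoin_induction (p := fun t _ => Differentiable ℝ t) ?_ ?_ ?_ ?_ ht
  · rintro t (⟨i, rfl⟩ | ⟨i, rfl⟩) θ
    · exact (hasFDerivAt_cos i θ).differentiableAt
    · exact (hasFDerivAt_sin i θ).differentiableAt
  · intro r
    exact differentiable_const r
  · intro s t _ _ hs ht
    exact hs.add ht
  · intro s t _ _ hs ht
    exact hs.mul ht

lemma partial_mem_trigPoly {k : ℕ} (j : Fin k) {t : (Fin k → ℝ) → ℝ} (ht : t ∈ TrigPoly k) :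
    (fun θ => fderiv ℝ t θ (Pi.single j 1)) ∈ TrigPoly k := by
  refine Algebra.adjoin_induction
    (p := fun t _ => (fun θ => fderiv ℝ t θ (Pi.single j 1)) ∈ TrigPoly k) ?_ ?_ ?_ ?_ ht
  · rintro t (⟨i, rfl⟩ | ⟨i, rfl⟩)
    · have h : (fun θ : Fin k → ℝ =>
          fderiv ℝ (fun θ : Fin k → ℝ => Real.cos (θ i)) θ (Pi.single j 1)) =
          (-(Pi.single j (1 : ℝ) : Fin k → ℝ) i) • (sinT i : (Fin k → ℝ) → ℝ) := by
        funext θ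
        rw [(hasFDerivAt_cos i θ).fderiv]
        simp [sinT, mul_comm]
      rw [h]
      exact (TrigPoly k).smul_mem (sinT i).2 _
    · have h : (fun θ : Fin k → ℝ =>
          fderiv ℝ (fun θ : Fin k → ℝ => Real.sin (θ i)) θ (Pi.single j 1)) =
          ((Pi.single j (1 : ℝ) : Fin k → ℝ) i) • (cosT i : (Fin k → ℝ) → ℝ) := by
        funext θ
        rw [(hasFDerivAt_sin i θ).fderiv]
        simp [cosT, mul_comm]
      rw [h]
      exact (TrigPoly k).smul_mem (cosT i).2 _
  · intro r
    have h : (fun θ : Fin k → ℝ =>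
        fderiv ℝ (algebraMap ℝ ((Fin k → ℝ) → ℝ) r) θ (Pi.single j 1)) = 0 := by
      funext θ
      have : (algebraMap ℝ ((Fin k → ℝ) → ℝ) r) = fun _ => r := rfl
      rw [this]
      simp
    rw [h]
    exact (TrigPoly k).zero_mem
  · intro s t hs ht hs' ht'
    have h : (fun θ : Fin k → ℝ => fderiv ℝ (s + t) θ (Pi.single j 1)) =
        (fun θ => fderiv ℝ s θ (Pi.single j 1)) + fun θ => fderiv ℝ t θ (Pi.single j 1) := by
      funext θ
      rw [fderiv_add (differentiable_of_mem_trigPoly hs θ) (differentiable_of_mem_trigPoly ht θ)]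
      rfl
    rw [h]
    exact (TrigPoly k).add_mem hs' ht'
  · intro s t hs ht hs' ht'
    have h : (fun θ : Fin k → ℝ => fderiv ℝ (s * t) θ (Pi.single j 1)) =
        s * (fun θ => fderiv ℝ t θ (Pi.single j 1)) +
          t * fun θ => fderiv ℝ s θ (Pi.single j 1) := by
      funext θ
      rw [fderiv_mul (differentiable_of_mem_trigPoly hs θ) (differentiable_of_mem_trigPoly ht θ)]
      rfl
    rw [h]
    exact (TrigPoly k).add_mem ((TrigPoly k).mul_mem hs ht') ((TrigPoly k).mul_mem ht hs')

/-- `∂/∂θ_j` on trigonometric polynomials. -/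
def dTrig {k : ℕ} (j : Fin k) (t : TrigPoly k) : TrigPoly k :=
  ⟨fun θ => fderiv ℝ (t : (Fin k → ℝ) → ℝ) θ (Pi.single j 1), partial_mem_trigPoly j t.2⟩

/-- Formal functions on the leaf: power series in `ρ` over the trigonometric polynomials. -/
abbrev LeafFun (k : ℕ) : Type := PowerSeries (TrigPoly k)

/-- The function `ρ = ρ_{σ(k)}`. -/
def rho {k : ℕ} : LeafFun k := PowerSeries.X

/-- `ρ ∂/∂ρ`, which is the operator `∑ⱼ (c_{σ(j)} / c_{σ(k)}) ρ_{σ(k)} ∂/∂ρ_{σ(j)}` applied to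
functions on the leaf. -/
def euler {k : ℕ} (F : LeafFun k) : LeafFun k :=
  rho * PowerSeries.derivative (TrigPoly k) F

/-- `∂/∂θ_j` on formal leaf functions. -/
def dTheta {k : ℕ} (j : Fin k) (F : LeafFun k) : LeafFun k :=
  PowerSeries.mk fun m => dTrig j (PowerSeries.coeff m F)

/-- Real formal power series in the `2k` variables `(X_j, Y_j)`; `Sum.inl j` stands for `X_j` and
`Sum.inr j` for `Y_j`. -/
abbrev CartSeries (k : ℕ) : Type := MvPowerSeries (Fin k ⊕ Fin k) ℝ

/-- The leaf functions `ρ cos θ_j` and `ρ sin θ_j`, `ρ = ρ_{σ(k)}`. -/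
def unitCoord {k : ℕ} : Fin k ⊕ Fin k → LeafFun k :=
  Sum.elim (fun j => rho * PowerSeries.C (cosT j)) (fun j => rho * PowerSeries.C (sinT j))

/-- The leaf function `∑_{α,β} h_{α,β} ρ^{|α|+|β|} cos^α θ sin^β θ` of a power series
`h = ∑ h_{α,β} X^α Y^β`. -/
def onLeaf {k : ℕ} (h : CartSeries k) : LeafFun k :=
  MvPowerSeries.subst (unitCoord (k := k)) h

/-! ### Leaf vector fields and near-identity changes of variables -/

/-- A formal leaf vector field
`radial · ∑ⱼ (c_{σ(j)} / c_{σ(k)}) ρ_{σ(k)} ∂/∂ρ_{σ(j)} + ∑ⱼ angular j · ∂/∂θ_{σ(j)}`, with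
coefficients of the form `∑ h_{α,β} ρ^{|α|+|β|} cos^α θ sin^β θ`. -/
structure LeafField (k : ℕ) where
  radial : CartSeries k
  angular : Fin k → CartSeries k

/-- The action of a leaf vector field on leaf functions. -/
def LeafField.apply {k : ℕ} (v : LeafField k) (F : LeafFun k) : LeafFun k :=
  onLeaf v.radial * euler F + ∑ j, onLeaf (v.angular j) * dTheta j F

/-- A formal near-identity change of the state variables preserving the leaf,
`ρ_{σ(j)} ↦ (1 + U) ρ_{σ(j)}`, `θ_{σ(j)} ↦ θ_{σ(j)} + Q_j`, expressing the old variables through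
the new ones.  Here `U` and `Q_j` are formal power series without constant term in the Cartesian
state variables, so in these variables the change is the identity plus terms of degree `≥ 2`. -/
structure NearIdentity (k : ℕ) where
  u : CartSeries k
  q : Fin k → CartSeries k
  u_zero : MvPowerSeries.constantCoeff u = 0
  q_zero : ∀ j, MvPowerSeries.constantCoeff (q j) = 0

namespace NearIdentity

variable {k : ℕ} (φ : NearIdentity k)

/-- The old `ρ = ρ_{σ(k)}` in the new variables. -/
def newRho : LeafFun k := rho * (1 + onLeaf φ.u)

/-- The difference `Q_j` between the old and the new angle `θ_{σ(j)}`. -/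
def shift (j : Fin k) : LeafFun k := onLeaf (φ.q j)

/-- The cosine of the old angle, `cos (θ_j + Q_j)`. -/
def newCos (j : Fin k) : LeafFun k :=
  PowerSeries.C (cosT j) * (PowerSeries.cos ℝ).subst (φ.shift j) -
    PowerSeries.C (sinT j) * (PowerSeries.sin ℝ).subst (φ.shift j)

/-- The sine of the old angle, `sin (θ_j + Q_j)`. -/
def newSin (j : Fin k) : LeafFun k :=
  PowerSeries.C (sinT j) * (PowerSeries.cos ℝ).subst (φ.shift j) +
    PowerSeries.C (cosT j) * (PowerSeries.sin ℝ).subst (φ.shift j)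

/-- The composition of the leaf function `onLeaf h` with the change of variables. -/
def pull (h : CartSeries k) : LeafFun k :=
  MvPowerSeries.subst
    (Sum.elim (fun j => φ.newRho * φ.newCos j) (fun j => φ.newRho * φ.newSin j)) h

/-- The change of variables `x = φ(y)` transforms `ẋ = v(x)` into `ẏ = w(y)`, that is
`Dφ · w = v ∘ φ`: differentiating the old `ρ` and the old `θ_j` along `w` gives the
`ρ`-component and the `θ_j`-component of `v`, composed with `φ`. -/
def Transforms (v w : LeafField k) : Prop :=
  w.apply φ.newRho = φ.newRho * φ.pull v.radial ∧
    ∀ j, onLeaf (w.angular j) + w.apply (φ.shift j) = φ.pull (v.angular j)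

end NearIdentity

/-! ### Leaf reduction of `Θ + ∑ Θ^i_{f_i} + E_g` -/

/-- The series `∑ h̃_{α,β} X^α Y^β`, over exponents of the `2k` variables of the leaf, with
`h̃_{α,β} = (∏ⱼ c_{σ(j)}^{α_j + β_j} / c_{σ(k)}^{|α|+|β|}) h_{α,β}`,
where `h_{α,β}` is the coefficient in `h` of the same monomial in `x_{σ(j)}, y_{σ(j)}`. -/
def reduced {k n : ℕ} (hk : 0 < k) (hkn : k ≤ n) (σ : Equiv.Perm (Fin n)) (c : Fin n → ℝ)
    (h : MvPowerSeries (Fin n ⊕ Fin n) ℝ) : CartSeries k :=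
  fun d =>
    (∏ j : Fin k, c (cellIdx hkn σ j) ^ (d (Sum.inl j) + d (Sum.inr j))) /
        c (cellIdx hkn σ (lastIdx hk)) ^ d.degree *
      MvPowerSeries.coeff (d.mapDomain (Sum.map (cellIdx hkn σ) (cellIdx hkn σ))) h

/-- The leaf vector field `Θ_k + v_{σ,C}`. -/
def leafReduction {k n : ℕ} (hk : 0 < k) (hkn : k ≤ n) (σ : Equiv.Perm (Fin n)) (c : Fin n → ℝ)
    (ω : Fin n → ℝ) (g : MvPowerSeries (Fin n ⊕ Fin n) ℝ)
    (f : Fin n → MvPowerSeries (Fin n ⊕ Fin n) ℝ) : LeafField k where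
  radial := reduced hk hkn σ c g
  angular j := MvPowerSeries.C (ω (cellIdx hkn σ j)) + reduced hk hkn σ c (f (cellIdx hkn σ j))

/-- Index set of the reduced coefficients: `(d, none)` for `ã_d` and `(d, some j)` for `b̃^j_d`,
with `d = (α, β)`. -/
abbrev CoeffIdx (k : ℕ) : Type := ((Fin k ⊕ Fin k) →₀ ℕ) × Option (Fin k)

/-- The reduced coefficients `ã_{α,β}(C)` and `b̃^j_{α,β}(C)`. -/
def reducedCoeff {k n : ℕ} (hk : 0 < k) (hkn : k ≤ n) (σ : Equiv.Perm (Fin n)) (c : Fin n → ℝ)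
    (g : MvPowerSeries (Fin n ⊕ Fin n) ℝ) (f : Fin n → MvPowerSeries (Fin n ⊕ Fin n) ℝ) :
    CoeffIdx k → ℝ
  | (d, none) => MvPowerSeries.coeff d (reduced hk hkn σ c g)
  | (d, some j) => MvPowerSeries.coeff d (reduced hk hkn σ c (f (cellIdx hkn σ j)))

/-! ### The first level normal form -/

/-- The Cartesian coordinate functions of the leaf: `(0, j)` gives
`x_{σ(j)} = (c_{σ(j)} / c_{σ(k)}) ρ_{σ(k)} cos θ_{σ(j)}` and `(1, j)` gives
`y_{σ(j)} = (c_{σ(j)} / c_{σ(k)}) ρ_{σ(k)} sin θ_{σ(j)}`. -/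
def cartCoord {k n : ℕ} (hk : 0 < k) (hkn : k ≤ n) (σ : Equiv.Perm (Fin n)) (c : Fin n → ℝ)
    (i : Fin 2 × Fin k) : LeafFun k :=
  (c (cellIdx hkn σ i.2) / c (cellIdx hkn σ (lastIdx hk))) •
    (![unitCoord (Sum.inl i.2), unitCoord (Sum.inr i.2)] i.1)

/-- The counterclockwise rotation by the angle `t`. -/
def rotation (t : ℝ) : Matrix (Fin 2) (Fin 2) ℝ :=
  !![Real.cos t, -Real.sin t; Real.sin t, Real.cos t]

/-- `(a² + b²)^{1/2} R_t`, where `t` is the polar angle of the point `(a, b)`. -/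
def rotScale (a b : ℝ) : Matrix (Fin 2) (Fin 2) ℝ :=
  Real.sqrt (a ^ 2 + b ^ 2) • rotation (Complex.arg ⟨a, b⟩)

/-- `diag(A_{1,p}, …, A_{k,p})` with `A_{i,p} = (a_p² + (b^i_p)²)^{1/2} R_{θ^i_p}`. -/
def blockMatrix {k : ℕ} (a : ℕ → ℝ) (b : Fin k → ℕ → ℝ) (p : ℕ) :
    Matrix (Fin 2 × Fin k) (Fin 2 × Fin k) ℝ :=
  Matrix.blockDiagonal fun i => rotScale (a p) (b i p)

/-- The leaf vector field `w` is, in Cartesian coordinates,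
`∑_p (x_{σ(k)}² + y_{σ(k)}²)^p A_p (x_{σ(1)}, y_{σ(1)}, …, x_{σ(k)}, y_{σ(k)})ᵗ`. -/
def IsNormalForm {k n : ℕ} (hk : 0 < k) (hkn : k ≤ n) (σ : Equiv.Perm (Fin n)) (c : Fin n → ℝ)
    (a : ℕ → ℝ) (b : Fin k → ℕ → ℝ) (w : LeafField k) : Prop :=
  ∀ i, w.apply (cartCoord hk hkn σ c i) =
    ∑ l, (PowerSeries.mk fun p => blockMatrix a b p i l).subst
        (cartCoord hk hkn σ c (0, lastIdx hk) ^ 2 + cartCoord hk hkn σ c (1, lastIdx hk) ^ 2) *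
      cartCoord hk hkn σ c l

end LeafNF

end

/-!
Normalizing the leaf vector field is carried out on power series in the Cartesian variables
`X_j, Y_j`, where the unknowns live; `onLeaf` maps the series of degree `m` onto the trigonometric
polynomials `homTrig k m` that are homogeneous of degree `m` in the cosines and sines.

Write the transformed field as `ω + W` and the change of variables as `q = (U, Q)`. Sorting the
conjugacy equation by degree puts it in the form `∑ⱼ ω_j ∂q/∂θ_j + W = N(q, W)`, where the terms
of degree `m` of `N` involve `q` and `W` in degrees `< m` only. The left-hand side is solved on
Fourier modes: by non-resonance `∑ⱼ ω_j ∂/∂θ_j` is invertible on the modes `cos ⟨n, θ⟩`,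
`sin ⟨n, θ⟩` with `n ≠ 0`, and the mode `n = 0` only occurs in even degree
(`exists_homological`). Hence `W` can be taken to restrict to an even power series in `ρ`, and
`q` and `W` are linear functions of `N`, applied degree by degree
(`exists_gradedOp_homological`). The equation becomes a fixed point equation for `N`
(`normalFormRHS`), whose right-hand side gains one degree of agreement
(`EqBelow.normalFormRHS`), so that iteration converges (`exists_fixedPoint`).

Each step of the iteration preserves the families of power series whose coefficients of degree `m`
are polynomials in the coefficients of degree `≤ m` of the given vector field
(`Filtered.normalFormRHS`). The polynomials of the statement are read off from the coefficients of
`ρ ^ (2 p)` in `W`. Finally, a field with components that are power series in `ρ ^ 2` acts on the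
Cartesian coordinates through the scaled rotations `rotScale` (`isNormalForm_of_onLeaf`).
-/

noncomputable section

namespace LeafNF

open Finset

variable {τ υ ι P : Type*}

/-! ### Power series up to a given degree -/

/-- Two power series agree in all degrees `< m`. -/
def EqBelow (m : ℕ) (F G : MvPowerSeries τ ℝ) : Prop :=
  ∀ d : τ →₀ ℕ, d.degree < m → MvPowerSeries.coeff d F = MvPowerSeries.coeff d G

namespace EqBelow

variable {m : ℕ} {F F' G G' K : MvPowerSeries τ ℝ}

lemma refl (m : ℕ) (F : MvPowerSeries τ ℝ) : EqBelow m F F := fun _ _ => rfl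

lemma trans (h : EqBelow m F G) (h' : EqBelow m G K) : EqBelow m F K :=
  fun d hd => (h d hd).trans (h' d hd)

lemma mono {m' : ℕ} (h : EqBelow m F G) (hm : m' ≤ m) : EqBelow m' F G :=
  fun d hd => h d (hd.trans_le hm)

lemma add (h : EqBelow m F G) (h' : EqBelow m F' G') : EqBelow m (F + F') (G + G') :=
  fun d hd => by simp [h d hd, h' d hd]

lemma sub (h : EqBelow m F G) (h' : EqBelow m F' G') : EqBelow m (F - F') (G - G') :=
  fun d hd => by simp [h d hd, h' d hd]

lemma sum {s : Finset ι} {F G : ι → MvPowerSeries τ ℝ} (h : ∀ i ∈ s, EqBelow m (F i) (G i)) :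
    EqBelow m (∑ i ∈ s, F i) (∑ i ∈ s, G i) := fun d hd => by
  rw [map_sum, map_sum]
  exact Finset.sum_congr rfl fun i hi => h i hi d hd

lemma mul (h : EqBelow m F G) (h' : EqBelow m F' G') : EqBelow m (F * F') (G * G') := by
  classical
  intro d hd
  rw [MvPowerSeries.coeff_mul, MvPowerSeries.coeff_mul]
  refine Finset.sum_congr rfl fun p hp => ?_
  have hdeg : p.1.degree + p.2.degree = d.degree := by
    rw [← map_add, mem_antidiagonal.mp hp]
  rw [h _ (by omega), h' _ (by omega)]

lemma pow (h : EqBelow m F G) (n : ℕ) : EqBelow m (F ^ n) (G ^ n) := by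
  induction n with
  | zero => simpa using refl m 1
  | succ n ih => simpa only [pow_succ] using ih.mul h

lemma prod {s : Finset ι} {F G : ι → MvPowerSeries τ ℝ} (h : ∀ i ∈ s, EqBelow m (F i) (G i)) :
    EqBelow m (∏ i ∈ s, F i) (∏ i ∈ s, G i) := by
  classical
  induction s using Finset.induction_on with
  | empty => simpa using refl m 1
  | insert i s hi ih =>
    rw [prod_insert hi, prod_insert hi]
    exact (h i (mem_insert_self i s)).mul (ih fun j hj => h j (mem_insert_of_mem hj))

/-- A factor without constant term needs the other factor to one degree less only. -/
lemma mul_succ (h : EqBelow (m + 1) F G) (hF : MvPowerSeries.constantCoeff F = 0)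
    (hG : MvPowerSeries.constantCoeff G = 0) (h' : EqBelow m F' G') :
    EqBelow (m + 1) (F * F') (G * G') := by
  classical
  intro d hd
  rw [MvPowerSeries.coeff_mul, MvPowerSeries.coeff_mul]
  refine Finset.sum_congr rfl fun p hp => ?_
  have hdeg : p.1.degree + p.2.degree = d.degree := by
    rw [← map_add, mem_antidiagonal.mp hp]
  rcases Nat.eq_zero_or_pos p.1.degree with h0 | h0
  · rw [(Finsupp.degree_eq_zero_iff _).mp h0, MvPowerSeries.coeff_zero_eq_constantCoeff_apply,
      MvPowerSeries.coeff_zero_eq_constantCoeff_apply, hF, hG, zero_mul, zero_mul]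
  · rw [h _ (by omega), h' _ (by omega)]

/-- A product of two series without constant term gains one degree of agreement. -/
lemma mul_gain (h : EqBelow m F G) (hF : MvPowerSeries.constantCoeff F = 0)
    (hG : MvPowerSeries.constantCoeff G = 0) (h' : EqBelow m F' G')
    (hF' : MvPowerSeries.constantCoeff F' = 0) (hG' : MvPowerSeries.constantCoeff G' = 0) :
    EqBelow (m + 1) (F * F') (G * G') := by
  classical
  intro d hd
  rw [MvPowerSeries.coeff_mul, MvPowerSeries.coeff_mul]
  refine Finset.sum_congr rfl fun p hp => ?_
  have hdeg : p.1.degree + p.2.degree = d.degree := by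
    rw [← map_add, mem_antidiagonal.mp hp]
  rcases Nat.eq_zero_or_pos p.1.degree with h0 | h0
  · rw [(Finsupp.degree_eq_zero_iff _).mp h0, MvPowerSeries.coeff_zero_eq_constantCoeff_apply,
      MvPowerSeries.coeff_zero_eq_constantCoeff_apply, hF, hG, zero_mul, zero_mul]
  · rcases Nat.eq_zero_or_pos p.2.degree with h1 | h1
    · rw [(Finsupp.degree_eq_zero_iff _).mp h1, MvPowerSeries.coeff_zero_eq_constantCoeff_apply
        (φ := F'), MvPowerSeries.coeff_zero_eq_constantCoeff_apply (φ := G'), hF', hG', mul_zero,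
        mul_zero]
    · rw [h _ (by omega), h' _ (by omega)]

lemma subst [Finite υ] {a b : υ → MvPowerSeries τ ℝ}
    (ha : ∀ i, MvPowerSeries.constantCoeff (a i) = 0)
    (hb : ∀ i, MvPowerSeries.constantCoeff (b i) = 0) (h : ∀ i, EqBelow m (a i) (b i))
    (f : MvPowerSeries υ ℝ) :
    EqBelow m (MvPowerSeries.subst a f) (MvPowerSeries.subst b f) := by
  intro e he
  rw [MvPowerSeries.coeff_subst (MvPowerSeries.hasSubst_of_constantCoeff_zero ha),
    MvPowerSeries.coeff_subst (MvPowerSeries.hasSubst_of_constantCoeff_zero hb)]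
  refine finsum_congr fun d => ?_
  rw [Finsupp.prod, Finsupp.prod, prod (fun i _ => (h i).pow (d i)) e he]

end EqBelow

/-- Fixed points of a map on tuples of power series without constant term that improves the
degree of agreement; `Φ^[n] 0` agrees with the fixed point in degrees `< n`. -/
lemma exists_fixedPoint (Φ : (ι → MvPowerSeries τ ℝ) → ι → MvPowerSeries τ ℝ)
    (h0 : ∀ Z, (∀ i, MvPowerSeries.constantCoeff (Z i) = 0) →
      ∀ i, MvPowerSeries.constantCoeff (Φ Z i) = 0)
    (hΦ : ∀ m Z Z', (∀ i, MvPowerSeries.constantCoeff (Z i) = 0) →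
      (∀ i, MvPowerSeries.constantCoeff (Z' i) = 0) → (∀ i, EqBelow m (Z i) (Z' i)) →
      ∀ i, EqBelow (m + 1) (Φ Z i) (Φ Z' i)) :
    ∃ Z, Φ Z = Z ∧ (∀ i, MvPowerSeries.constantCoeff (Z i) = 0) ∧
      ∀ n i, EqBelow n (Z i) (Φ^[n] 0 i) := by
  have hc : ∀ n i, MvPowerSeries.constantCoeff (Φ^[n] 0 i) = 0 := by
    intro n
    induction n with
    | zero => simp
    | succ n ih => rw [Function.iterate_succ_apply']; exact h0 _ ih
  have hstep : ∀ n i, EqBelow n (Φ^[n] 0 i) (Φ^[n + 1] 0 i) := by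
    intro n
    induction n with
    | zero => intro i d hd; exact absurd hd (Nat.not_lt_zero _)
    | succ n ih =>
      rw [Function.iterate_succ_apply', Function.iterate_succ_apply' Φ (n + 1)]
      exact hΦ n _ _ (hc n) (hc (n + 1)) ih
  have hle : ∀ n m, n ≤ m → ∀ i, EqBelow n (Φ^[n] 0 i) (Φ^[m] 0 i) := by
    intro n m hnm
    induction m, hnm using Nat.le_induction with
    | base => exact fun i => EqBelow.refl _ _
    | succ m hm ih => exact fun i => (ih i).trans ((hstep m i).mono hm)
  let Z : ι → MvPowerSeries τ ℝ := fun i d => MvPowerSeries.coeff d (Φ^[d.degree + 1] 0 i)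
  have hZ : ∀ n i, EqBelow n (Z i) (Φ^[n] 0 i) := fun n i d hd =>
    hle (d.degree + 1) n hd i d (Nat.lt_succ_self _)
  have hZ0 : ∀ i, MvPowerSeries.constantCoeff (Z i) = 0 := fun i => by
    rw [← MvPowerSeries.coeff_zero_eq_constantCoeff_apply, hZ 1 i 0 (by simp),
      MvPowerSeries.coeff_zero_eq_constantCoeff_apply, hc]
  refine ⟨Z, ?_, hZ0, hZ⟩
  funext i
  refine MvPowerSeries.ext fun d => ?_
  rw [hΦ d.degree Z (Φ^[d.degree] 0) hZ0 (hc _) (hZ _) i d (Nat.lt_succ_self _),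
    hZ (d.degree + 1) i d (Nat.lt_succ_self _), Function.iterate_succ_apply']

/-! ### Families of power series with filtered dependence on parameters -/

/-- The exponents of degree `m`. -/
def expsOfDegree (τ : Type*) [Finite τ] (m : ℕ) : Finset (τ →₀ ℕ) :=
  (Finsupp.finite_of_degree_eq (σ := τ) m).toFinset

@[simp] lemma mem_expsOfDegree [Finite τ] {m : ℕ} {d : τ →₀ ℕ} :
    d ∈ expsOfDegree τ m ↔ d.degree = m := by
  simp [expsOfDegree]

/-- The exponents of degree at most `m`. -/
def expsOfDegreeLE (τ : Type*) [Finite τ] (m : ℕ) : Finset (τ →₀ ℕ) :=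
  (Finsupp.finite_of_degree_le (σ := τ) m).toFinset

@[simp] lemma mem_expsOfDegreeLE [Finite τ] {m : ℕ} {d : τ →₀ ℕ} :
    d ∈ expsOfDegreeLE τ m ↔ d.degree ≤ m := by
  simp [expsOfDegreeLE]

/-- A family of power series, indexed by parameters in `P`, whose coefficients of degree `m`
belong to the algebra `A m` of functions of the parameters. -/
def Filtered (A : ℕ → Subalgebra ℝ (P → ℝ)) (F : P → MvPowerSeries τ ℝ) : Prop :=
  ∀ d, (fun s => MvPowerSeries.coeff d (F s)) ∈ A d.degree

namespace Filtered

variable {A : ℕ → Subalgebra ℝ (P → ℝ)} {F G : P → MvPowerSeries τ ℝ}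

lemma const (F : MvPowerSeries τ ℝ) : Filtered A fun _ => F := fun d =>
  (A d.degree).algebraMap_mem (MvPowerSeries.coeff d F)

lemma add (hF : Filtered A F) (hG : Filtered A G) : Filtered A fun s => F s + G s :=
  fun d => by simp only [map_add]; exact (A d.degree).add_mem (hF d) (hG d)

lemma sub (hF : Filtered A F) (hG : Filtered A G) : Filtered A fun s => F s - G s :=
  fun d => by simp only [map_sub]; exact (A d.degree).sub_mem (hF d) (hG d)

lemma sum {t : Finset ι} {F : ι → P → MvPowerSeries τ ℝ} (hF : ∀ i ∈ t, Filtered A (F i)) :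
    Filtered A fun s => ∑ i ∈ t, F i s := fun d => by
  have : (fun s => MvPowerSeries.coeff d (∑ i ∈ t, F i s)) =
      ∑ i ∈ t, fun s => MvPowerSeries.coeff d (F i s) := by
    funext s; simp [map_sum]
  rw [this]
  exact (A d.degree).sum_mem fun i hi => hF i hi d

lemma mul (hA : Monotone A) (hF : Filtered A F) (hG : Filtered A G) :
    Filtered A fun s => F s * G s := fun d => by
  classical
  have : (fun s => MvPowerSeries.coeff d (F s * G s)) = ∑ p ∈ antidiagonal d,
      (fun s => MvPowerSeries.coeff p.1 (F s)) * fun s => MvPowerSeries.coeff p.2 (G s) := by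
    funext s; simp [MvPowerSeries.coeff_mul]
  rw [this]
  refine (A d.degree).sum_mem fun p hp => ?_
  have hdeg : p.1.degree + p.2.degree = d.degree := by
    rw [← map_add, mem_antidiagonal.mp hp]
  exact (A d.degree).mul_mem (hA (by omega) (hF p.1)) (hA (by omega) (hG p.2))

lemma pow (hA : Monotone A) (hF : Filtered A F) (n : ℕ) : Filtered A fun s => F s ^ n := by
  induction n with
  | zero => simpa using const 1
  | succ n ih => simpa only [pow_succ] using ih.mul hA hF

lemma prod (hA : Monotone A) {t : Finset ι} {F : ι → P → MvPowerSeries τ ℝ}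
    (hF : ∀ i ∈ t, Filtered A (F i)) : Filtered A fun s => ∏ i ∈ t, F i s := by
  classical
  induction t using Finset.induction_on with
  | empty => simpa using const 1
  | insert i t hi ih =>
    simp only [prod_insert hi]
    exact (hF i (mem_insert_self i t)).mul hA (ih fun j hj => hF j (mem_insert_of_mem hj))

end Filtered

/-- A product of powers of series without constant term has no terms below its total degree. -/
lemma coeff_prod_pow_eq_zero {a : υ → MvPowerSeries τ ℝ}
    (ha : ∀ i, MvPowerSeries.constantCoeff (a i) = 0) (d : υ →₀ ℕ) (e : τ →₀ ℕ)
    (h : e.degree < d.degree) :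
    MvPowerSeries.coeff e (d.prod fun i n => a i ^ n) = 0 := by
  refine MvPowerSeries.coeff_of_lt_order (lt_of_lt_of_le (Nat.cast_lt.mpr h) ?_)
  rw [Finsupp.prod, Finsupp.degree_apply, Nat.cast_sum]
  refine le_trans (Finset.sum_le_sum fun i _ => ?_) (MvPowerSeries.le_order_prod _ _)
  refine le_trans ?_ (MvPowerSeries.le_order_pow _)
  have : 1 ≤ (a i).order := MvPowerSeries.one_le_order_iff_constCoeff_eq_zero.mpr (ha i)
  calc ((d i : ℕ) : ℕ∞) = d i • (1 : ℕ∞) := by simp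
    _ ≤ d i • (a i).order := nsmul_le_nsmul_right this _

/-- The coefficients of a substitution of series without constant term as finite sums. -/
lemma coeff_subst_eq_sum [Finite υ] {a : υ → MvPowerSeries τ ℝ}
    (ha : ∀ i, MvPowerSeries.constantCoeff (a i) = 0) (f : MvPowerSeries υ ℝ) (e : τ →₀ ℕ) :
    MvPowerSeries.coeff e (MvPowerSeries.subst a f) =
      ∑ d ∈ expsOfDegreeLE υ e.degree, MvPowerSeries.coeff d f *
        MvPowerSeries.coeff e (d.prod fun i n => a i ^ n) := by
  rw [MvPowerSeries.coeff_subst (MvPowerSeries.hasSubst_of_constantCoeff_zero ha)]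
  refine finsum_eq_sum_of_support_subset _ fun d hd => ?_
  rw [mem_coe, mem_expsOfDegreeLE]
  by_contra hlt
  refine hd ?_
  simp only [smul_eq_mul]
  rw [coeff_prod_pow_eq_zero ha d e (by omega), mul_zero]

protected lemma Filtered.subst [Finite υ] {A : ℕ → Subalgebra ℝ (P → ℝ)} (hA : Monotone A)
    {a : υ → P → MvPowerSeries τ ℝ} (ha0 : ∀ i s, MvPowerSeries.constantCoeff (a i s) = 0)
    (ha : ∀ i, Filtered A (a i)) {f : P → MvPowerSeries υ ℝ} (hf : Filtered A f) :
    Filtered A fun s => MvPowerSeries.subst (fun i => a i s) (f s) := by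
  intro e
  have : (fun s => MvPowerSeries.coeff e (MvPowerSeries.subst (fun i => a i s) (f s))) =
      ∑ d ∈ expsOfDegreeLE υ e.degree, (fun s => MvPowerSeries.coeff d (f s)) *
        fun s => MvPowerSeries.coeff e (d.prod fun i n => a i s ^ n) := by
    funext s
    simp [coeff_subst_eq_sum (fun i => ha0 i s)]
  rw [this]
  refine (A e.degree).sum_mem fun d hd => (A e.degree).mul_mem ?_ ?_
  · exact hA (mem_expsOfDegreeLE.mp hd) (hf d)
  · exact Filtered.prod hA (fun i _ => (ha i).pow hA (d i)) e

/-! ### Degree-preserving linear operators -/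

/-- The degree-preserving linear operator on power series with matrix `t` in the basis of
monomials, `t d e` being the coefficient of `X ^ e` in the image of `X ^ d`.  Entries `t d e` with
`|d| ≠ |e|` are ignored. -/
def gradedOp [Finite τ] (t : (τ →₀ ℕ) → (τ →₀ ℕ) → ℝ) (F : MvPowerSeries τ ℝ) :
    MvPowerSeries τ ℝ :=
  fun e => ∑ d ∈ expsOfDegree τ e.degree, MvPowerSeries.coeff d F * t d e

section GradedOp

variable [Finite τ] (t : (τ →₀ ℕ) → (τ →₀ ℕ) → ℝ)

lemma coeff_gradedOp (F : MvPowerSeries τ ℝ) (e : τ →₀ ℕ) :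
    MvPowerSeries.coeff e (gradedOp t F) =
      ∑ d ∈ expsOfDegree τ e.degree, MvPowerSeries.coeff d F * t d e := rfl

lemma constantCoeff_gradedOp {F : MvPowerSeries τ ℝ} (hF : MvPowerSeries.constantCoeff F = 0) :
    MvPowerSeries.constantCoeff (gradedOp t F) = 0 := by
  rw [← MvPowerSeries.coeff_zero_eq_constantCoeff_apply, coeff_gradedOp]
  refine Finset.sum_eq_zero fun d hd => ?_
  rw [(Finsupp.degree_eq_zero_iff d).mp (by simpa using hd),
    MvPowerSeries.coeff_zero_eq_constantCoeff_apply, hF, zero_mul]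

protected lemma EqBelow.gradedOp {m : ℕ} {F G : MvPowerSeries τ ℝ} (h : EqBelow m F G) :
    EqBelow m (gradedOp t F) (gradedOp t G) := by
  intro e he
  rw [coeff_gradedOp, coeff_gradedOp]
  refine Finset.sum_congr rfl fun d hd => ?_
  rw [h d (by rw [mem_expsOfDegree] at hd; omega)]

protected lemma Filtered.gradedOp {A : ℕ → Subalgebra ℝ (P → ℝ)} {F : P → MvPowerSeries τ ℝ}
    (hF : Filtered A F) : Filtered A fun s => gradedOp t (F s) := by
  intro e
  have : (fun s => MvPowerSeries.coeff e (LeafNF.gradedOp t (F s))) =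
      ∑ d ∈ expsOfDegree τ e.degree, t d e • fun s => MvPowerSeries.coeff d (F s) := by
    funext s
    simp [coeff_gradedOp, mul_comm]
  rw [this]
  refine (A e.degree).sum_mem fun d hd => (A e.degree).smul_mem ?_ _
  rw [← mem_expsOfDegree.mp hd]
  exact hF d

end GradedOp

variable {k : ℕ}

/-! ### Homogeneous trigonometric polynomials -/

lemma dTrig_apply (j : Fin k) (t : TrigPoly k) (θ : Fin k → ℝ) :
    (dTrig j t : (Fin k → ℝ) → ℝ) θ =
      fderiv ℝ (t : (Fin k → ℝ) → ℝ) θ (Pi.single j 1) := rfl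

/-- `∂/∂θ_j` as a derivation of the algebra of trigonometric polynomials. -/
def dTrigDer (j : Fin k) : Derivation ℝ (TrigPoly k) (TrigPoly k) :=
  Derivation.mk'
    { toFun := dTrig j
      map_add' := fun s t => by
        ext θ
        simp [dTrig_apply, fderiv_add (differentiable_of_mem_trigPoly s.2 θ)
          (differentiable_of_mem_trigPoly t.2 θ)]
      map_smul' := fun r t => by
        ext θ
        simp [dTrig_apply, fderiv_const_smul (differentiable_of_mem_trigPoly t.2 θ)] }
    fun s t => by
      ext θ
      simp [dTrig_apply, fderiv_mul (differentiable_of_mem_trigPoly s.2 θ)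
          (differentiable_of_mem_trigPoly t.2 θ)]

@[simp] lemma dTrigDer_apply (j : Fin k) (t : TrigPoly k) : dTrigDer j t = dTrig j t := rfl

lemma dTrig_cosT (j i : Fin k) : dTrig j (cosT i) = -((if i = j then (1 : ℝ) else 0) • sinT i) := by
  ext θ
  rw [dTrig_apply,
    show ((cosT i : TrigPoly k) : (Fin k → ℝ) → ℝ) = fun θ => Real.cos (θ i) from rfl,
    (hasFDerivAt_cos i θ).fderiv]
  split_ifs with h <;> simp [sinT, h]

lemma dTrig_sinT (j i : Fin k) : dTrig j (sinT i) = (if i = j then (1 : ℝ) else 0) • cosT i := by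
  ext θ
  rw [dTrig_apply,
    show ((sinT i : TrigPoly k) : (Fin k → ℝ) → ℝ) = fun θ => Real.sin (θ i) from rfl,
    (hasFDerivAt_sin i θ).fderiv]
  split_ifs with h <;> simp [cosT, h]

/-- `cos θ_j` for `Sum.inl j`, `sin θ_j` for `Sum.inr j`. -/
def trigVar : Fin k ⊕ Fin k → TrigPoly k := Sum.elim cosT sinT

/-- The trigonometric monomial `cos^α θ sin^β θ`. -/
def trigMon (d : Fin k ⊕ Fin k →₀ ℕ) : TrigPoly k := d.prod fun i n => trigVar i ^ n

lemma trigMon_zero : trigMon (0 : Fin k ⊕ Fin k →₀ ℕ) = 1 := by simp [trigMon]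

lemma trigMon_add (d e : Fin k ⊕ Fin k →₀ ℕ) : trigMon (d + e) = trigMon d * trigMon e :=
  Finsupp.prod_add_index' (by simp) (by simp [pow_add])

lemma trigMon_single (i : Fin k ⊕ Fin k) : trigMon (Finsupp.single i 1) = trigVar i := by
  simp [trigMon]

/-- The trigonometric polynomials that are homogeneous of degree `m` in the cosines and sines. -/
def homTrig (k m : ℕ) : Submodule ℝ (TrigPoly k) :=
  Submodule.span ℝ (trigMon '' {d : Fin k ⊕ Fin k →₀ ℕ | d.degree = m})

lemma trigMon_mem (d : Fin k ⊕ Fin k →₀ ℕ) : trigMon d ∈ homTrig k d.degree :=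
  Submodule.subset_span ⟨d, rfl, rfl⟩

lemma one_mem_homTrig_zero : (1 : TrigPoly k) ∈ homTrig k 0 := by
  simpa [trigMon_zero] using trigMon_mem (0 : Fin k ⊕ Fin k →₀ ℕ)

lemma trigVar_mul_mem (i : Fin k ⊕ Fin k) {m : ℕ} {f : TrigPoly k} (hf : f ∈ homTrig k m) :
    trigVar i * f ∈ homTrig k (m + 1) := by
  induction hf using Submodule.span_induction with
  | mem f hf =>
    obtain ⟨d, hd, rfl⟩ := hf
    rw [← trigMon_single, ← trigMon_add]
    have : (Finsupp.single i 1 + d).degree = m + 1 := by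
      rw [map_add, Finsupp.degree_single, hd, add_comm]
    exact this ▸ trigMon_mem _
  | zero => simp
  | add f g _ _ hf hg => rw [mul_add]; exact add_mem hf hg
  | smul r f _ hf => rw [mul_smul_comm]; exact Submodule.smul_mem _ r hf

lemma exists_dTrig_trigVar (j : Fin k) (i : Fin k ⊕ Fin k) :
    ∃ (r : ℝ) (i' : Fin k ⊕ Fin k), dTrig j (trigVar i) = r • trigVar i' := by
  rcases i with i | i
  · exact ⟨-(if i = j then (1 : ℝ) else 0), Sum.inr i, by
      rw [neg_smul]; exact dTrig_cosT j i⟩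
  · exact ⟨_, Sum.inl i, dTrig_sinT j i⟩

/-- Induction on exponents, one variable at a time. -/
lemma exponent_induction {σ : Type*} {p : (σ →₀ ℕ) → Prop} (zero : p 0)
    (step : ∀ i d, p d → p (Finsupp.single i 1 + d)) (d : σ →₀ ℕ) : p d := by
  refine Finsupp.induction_linear (motive := fun e => ∀ d, p d → p (e + d)) d ?_ ?_ ?_ 0 zero
    |> fun h => by simpa using h
  · intro d hd; simpa using hd
  · intro f g hf hg d hd; rw [add_assoc]; exact hf _ (hg _ hd)
  · intro i n
    induction n with
    | zero => intro d hd; simpa using hd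
    | succ n ih =>
      intro d hd
      rw [Finsupp.single_add, add_assoc]
      exact ih _ (step i d hd)

lemma dTrig_mem (j : Fin k) {m : ℕ} {f : TrigPoly k} (hf : f ∈ homTrig k m) :
    dTrig j f ∈ homTrig k m := by
  rw [← dTrigDer_apply]
  induction hf using Submodule.span_induction with
  | mem f hf =>
    obtain ⟨d, rfl, rfl⟩ := hf
    induction d using exponent_induction with
    | zero => simp [trigMon_zero]
    | step i d ih =>
      obtain ⟨r, i', h⟩ := exists_dTrig_trigVar j i
      rw [trigMon_add, trigMon_single, Derivation.leibniz, dTrigDer_apply j (trigVar i), h,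
        map_add, Finsupp.degree_single, add_comm 1, smul_eq_mul, smul_eq_mul, mul_smul_comm,
        mul_comm (trigMon d)]
      exact add_mem (trigVar_mul_mem i ih)
        (Submodule.smul_mem _ r (trigVar_mul_mem i' (trigMon_mem d)))
  | zero => rw [map_zero]; exact zero_mem _
  | add f g _ _ hf hg => rw [map_add]; exact add_mem hf hg
  | smul r f _ hf => rw [Derivation.map_smul]; exact Submodule.smul_mem _ r hf

lemma exists_coeffs_of_mem {m : ℕ} {f : TrigPoly k} (hf : f ∈ homTrig k m) :
    ∃ t : (Fin k ⊕ Fin k →₀ ℕ) → ℝ, f = ∑ e ∈ expsOfDegree (Fin k ⊕ Fin k) m, t e • trigMon e := by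
  have : trigMon '' {d : Fin k ⊕ Fin k →₀ ℕ | d.degree = m} =
      trigMon '' (expsOfDegree (Fin k ⊕ Fin k) m : Set (Fin k ⊕ Fin k →₀ ℕ)) := by
    congr 1; ext d; simp
  rw [homTrig, this] at hf
  obtain ⟨t, ht, rfl⟩ := (Finsupp.mem_span_image_iff_linearCombination ℝ).mp hf
  refine ⟨t, ?_⟩
  rw [Finsupp.linearCombination_apply, Finsupp.sum]
  refine Finset.sum_subset ((Finsupp.mem_supported ℝ t).mp ht) fun e _ he => ?_
  rw [Finsupp.notMem_support_iff.mp he, zero_smul]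

/-! ### The homological equation on trigonometric polynomials -/

/-- `∑ⱼ ω_j ∂/∂θ_j`. -/
def rotDer (ω : Fin k → ℝ) : TrigPoly k →ₗ[ℝ] TrigPoly k :=
  ∑ j, ω j • (dTrigDer j : TrigPoly k →ₗ[ℝ] TrigPoly k)

lemma rotDer_apply (ω : Fin k → ℝ) (f : TrigPoly k) : rotDer ω f = ∑ j, ω j • dTrig j f := by
  simp [rotDer]

lemma rotDer_mem (ω : Fin k → ℝ) {m : ℕ} {f : TrigPoly k} (hf : f ∈ homTrig k m) :
    rotDer ω f ∈ homTrig k m := by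
  rw [rotDer_apply]
  exact sum_mem fun j _ => Submodule.smul_mem _ _ (dTrig_mem j hf)

/-- `C` and `S` are the Fourier modes `cos ⟨n, θ⟩` and `sin ⟨n, θ⟩` for some `n ∈ ℤᵏ`, both
homogeneous of degree `m`; the parity of `∑ nⱼ` is that of `m`. -/
structure IsModePair (m : ℕ) (n : Fin k → ℤ) (C S : TrigPoly k) : Prop where
  cos_mem : C ∈ homTrig k m
  sin_mem : S ∈ homTrig k m
  cos_eq : ∀ θ, (C : (Fin k → ℝ) → ℝ) θ = Real.cos (∑ i, n i * θ i)
  sin_eq : ∀ θ, (S : (Fin k → ℝ) → ℝ) θ = Real.sin (∑ i, n i * θ i)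
  even : Even (m + ∑ i, n i)

lemma IsModePair.zero : IsModePair 0 (0 : Fin k → ℤ) 1 0 where
  cos_mem := one_mem_homTrig_zero
  sin_mem := zero_mem _
  cos_eq := by simp
  sin_eq := by simp
  even := by simp

lemma sum_add_single_mul (n : Fin k → ℤ) (j : Fin k) (z : ℤ) (θ : Fin k → ℝ) :
    ∑ i, ((n + Pi.single j z : Fin k → ℤ) i : ℝ) * θ i = (∑ i, n i * θ i) + z * θ j := by
  simp [add_mul, Finset.sum_add_distrib, Pi.single_apply]

lemma IsModePair.up {m : ℕ} {n : Fin k → ℤ} {C S : TrigPoly k} (h : IsModePair m n C S)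
    (j : Fin k) : IsModePair (m + 1) (n + Pi.single j 1) (cosT j * C - sinT j * S)
      (sinT j * C + cosT j * S) where
  cos_mem := sub_mem (trigVar_mul_mem (Sum.inl j) h.cos_mem) (trigVar_mul_mem (Sum.inr j) h.sin_mem)
  sin_mem := add_mem (trigVar_mul_mem (Sum.inr j) h.cos_mem) (trigVar_mul_mem (Sum.inl j) h.sin_mem)
  cos_eq θ := by
    rw [sum_add_single_mul, Int.cast_one, one_mul, Real.cos_add, ← h.cos_eq, ← h.sin_eq]
    simp [cosT, sinT, mul_comm]
  sin_eq θ := by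
    rw [sum_add_single_mul, Int.cast_one, one_mul, Real.sin_add, ← h.cos_eq, ← h.sin_eq]
    simp [cosT, sinT, mul_comm]
    ring
  even := by
    have := h.even
    simp only [Pi.add_apply, Finset.sum_add_distrib, Finset.sum_pi_single', Finset.mem_univ,
      if_true, Nat.cast_add, Nat.cast_one]
    rw [Int.even_iff] at this ⊢
    omega

lemma IsModePair.down {m : ℕ} {n : Fin k → ℤ} {C S : TrigPoly k} (h : IsModePair m n C S)
    (j : Fin k) : IsModePair (m + 1) (n + Pi.single j (-1)) (cosT j * C + sinT j * S)
      (cosT j * S - sinT j * C) where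
  cos_mem := add_mem (trigVar_mul_mem (Sum.inl j) h.cos_mem) (trigVar_mul_mem (Sum.inr j) h.sin_mem)
  sin_mem := sub_mem (trigVar_mul_mem (Sum.inl j) h.sin_mem) (trigVar_mul_mem (Sum.inr j) h.cos_mem)
  cos_eq θ := by
    rw [sum_add_single_mul, Int.cast_neg, Int.cast_one, neg_one_mul, ← sub_eq_add_neg,
      Real.cos_sub, ← h.cos_eq, ← h.sin_eq]
    simp [cosT, sinT, mul_comm]
  sin_eq θ := by
    rw [sum_add_single_mul, Int.cast_neg, Int.cast_one, neg_one_mul, ← sub_eq_add_neg,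
      Real.sin_sub, ← h.cos_eq, ← h.sin_eq]
    simp [cosT, sinT, mul_comm]
  even := by
    have := h.even
    simp only [Pi.add_apply, Finset.sum_add_distrib, Finset.sum_pi_single', Finset.mem_univ,
      if_true, Nat.cast_add, Nat.cast_one]
    rw [Int.even_iff] at this ⊢
    omega

/-- The span of the Fourier modes of degree `m`. -/
def modeSpan (k m : ℕ) : Submodule ℝ (TrigPoly k) :=
  Submodule.span ℝ {f | ∃ n C S, IsModePair m n C S ∧ (f = C ∨ f = S)}

lemma trigVar_mul_mem_modeSpan (i : Fin k ⊕ Fin k) {m : ℕ} {f : TrigPoly k}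
    (hf : f ∈ modeSpan k m) : trigVar i * f ∈ modeSpan k (m + 1) := by
  induction hf using Submodule.span_induction with
  | mem f hf =>
    obtain ⟨n, C, S, h, hf⟩ := hf
    -- The product-to-sum formulas express each product through the modes `n ± e_j`.
    have key : ∀ j, (cosT j * C ∈ modeSpan k (m + 1) ∧ cosT j * S ∈ modeSpan k (m + 1)) ∧
        (sinT j * C ∈ modeSpan k (m + 1) ∧ sinT j * S ∈ modeSpan k (m + 1)) := by
      intro j
      have uC : cosT j * C - sinT j * S ∈ modeSpan k (m + 1) :=
        Submodule.subset_span ⟨_, _, _, h.up j, Or.inl rfl⟩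
      have uS : sinT j * C + cosT j * S ∈ modeSpan k (m + 1) :=
        Submodule.subset_span ⟨_, _, _, h.up j, Or.inr rfl⟩
      have dC : cosT j * C + sinT j * S ∈ modeSpan k (m + 1) :=
        Submodule.subset_span ⟨_, _, _, h.down j, Or.inl rfl⟩
      have dS : cosT j * S - sinT j * C ∈ modeSpan k (m + 1) :=
        Submodule.subset_span ⟨_, _, _, h.down j, Or.inr rfl⟩
      refine ⟨⟨?_, ?_⟩, ?_, ?_⟩
      · convert Submodule.smul_mem _ (2⁻¹ : ℝ) (add_mem uC dC) using 1
        module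
      · convert Submodule.smul_mem _ (2⁻¹ : ℝ) (add_mem uS dS) using 1
        module
      · convert Submodule.smul_mem _ (2⁻¹ : ℝ) (sub_mem uS dS) using 1
        module
      · convert Submodule.smul_mem _ (2⁻¹ : ℝ) (sub_mem dC uC) using 1
        module
    rcases i with j | j <;> rcases hf with rfl | rfl
    exacts [(key j).1.1, (key j).1.2, (key j).2.1, (key j).2.2]
  | zero => simp
  | add f g _ _ hf hg => rw [mul_add]; exact add_mem hf hg
  | smul r f _ hf => rw [mul_smul_comm]; exact Submodule.smul_mem _ r hf

lemma homTrig_le_modeSpan (m : ℕ) : homTrig k m ≤ modeSpan k m := by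
  refine Submodule.span_le.mpr ?_
  rintro _ ⟨d, rfl, rfl⟩
  induction d using exponent_induction with
  | zero =>
    rw [trigMon_zero, map_zero]
    exact Submodule.subset_span ⟨_, _, _, IsModePair.zero, Or.inl rfl⟩
  | step i d ih =>
    rw [trigMon_add, trigMon_single, map_add, Finsupp.degree_single, add_comm 1]
    exact trigVar_mul_mem_modeSpan i ih

lemma hasFDerivAt_phase (n : Fin k → ℤ) (θ : Fin k → ℝ) :
    HasFDerivAt (fun θ : Fin k → ℝ => ∑ i, n i * θ i)
      (∑ i, (n i : ℝ) • (ContinuousLinearMap.proj i : (Fin k → ℝ) →L[ℝ] ℝ)) θ :=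
  HasFDerivAt.fun_sum fun i _ => (hasFDerivAt_apply (𝕜 := ℝ) i θ).const_mul (n i : ℝ)

lemma IsModePair.dTrig_cos {m : ℕ} {n : Fin k → ℤ} {C S : TrigPoly k} (h : IsModePair m n C S)
    (j : Fin k) : dTrig j C = -(n j : ℝ) • S := by
  ext θ
  rw [dTrig_apply, show (C : (Fin k → ℝ) → ℝ) = fun θ => Real.cos (∑ i, n i * θ i) from
    funext h.cos_eq, (hasFDerivAt_phase n θ).cos.fderiv]
  simp [h.sin_eq, Pi.single_apply, mul_comm]

lemma IsModePair.dTrig_sin {m : ℕ} {n : Fin k → ℤ} {C S : TrigPoly k} (h : IsModePair m n C S)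
    (j : Fin k) : dTrig j S = (n j : ℝ) • C := by
  ext θ
  rw [dTrig_apply, show (S : (Fin k → ℝ) → ℝ) = fun θ => Real.sin (∑ i, n i * θ i) from
    funext h.sin_eq, (hasFDerivAt_phase n θ).sin.fderiv]
  simp [h.cos_eq, Pi.single_apply, mul_comm]

/-- The homological equation. Under non-resonance `∑ⱼ ω_j ∂/∂θ_j` is invertible on the Fourier
modes `n ≠ 0`, so that a homogeneous trigonometric polynomial differs from a derivative by its
mean, which vanishes in odd degree. -/
lemma exists_homological {ω : Fin k → ℝ} (hω : LinearIndependent ℚ ω) {m : ℕ} {f : TrigPoly k}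
    (hf : f ∈ homTrig k m) :
    ∃ u ∈ homTrig k m, ∃ a : ℝ, (Odd m → a = 0) ∧ rotDer ω u + a • 1 = f := by
  replace hf := homTrig_le_modeSpan m hf
  induction hf using Submodule.span_induction with
  | mem f hf =>
    obtain ⟨n, C, S, h, hf⟩ := hf
    have hC : rotDer ω C = -(∑ j, ω j * n j) • S := by
      rw [rotDer_apply, ← Finset.sum_neg_distrib, Finset.sum_smul]
      exact Finset.sum_congr rfl fun j _ => by rw [h.dTrig_cos, smul_smul, mul_neg]
    have hS : rotDer ω S = (∑ j, ω j * n j) • C := by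
      rw [rotDer_apply, Finset.sum_smul]
      exact Finset.sum_congr rfl fun j _ => by rw [h.dTrig_sin, smul_smul]
    by_cases h0 : ∑ j, ω j * (n j : ℝ) = 0
    · -- A mode of zero frequency is `n = 0`.
      have hn : n = 0 := by
        have := Fintype.linearIndependent_iff.mp hω (fun j => (n j : ℚ)) (by
          rw [← h0]
          exact Finset.sum_congr rfl fun j _ => by rw [Rat.smul_def]; push_cast; ring)
        funext j
        exact_mod_cast this j
      subst hn
      rcases hf with rfl | rfl
      · refine ⟨0, zero_mem _, 1, fun hm => ?_, ?_⟩
        · have := h.even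
          simp only [Pi.zero_apply, Finset.sum_const_zero, add_zero, Int.even_coe_nat] at this
          exact absurd this (Nat.not_even_iff_odd.mpr hm)
        · ext θ
          simp [h.cos_eq]
      · refine ⟨0, zero_mem _, 0, fun _ => rfl, ?_⟩
        ext θ
        simp [h.sin_eq]
    · rcases hf with rfl | rfl
      · refine ⟨(∑ j, ω j * (n j : ℝ))⁻¹ • S, Submodule.smul_mem _ _ h.sin_mem, 0, fun _ => rfl, ?_⟩
        rw [map_smul, hS, smul_smul, inv_mul_cancel₀ h0, one_smul, zero_smul, add_zero]
      · refine ⟨-(∑ j, ω j * (n j : ℝ))⁻¹ • C, Submodule.smul_mem _ _ h.cos_mem, 0,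
          fun _ => rfl, ?_⟩
        rw [map_smul, hC, smul_smul, neg_mul_neg, inv_mul_cancel₀ h0, one_smul, zero_smul, add_zero]
  | zero => exact ⟨0, zero_mem _, 0, fun _ => rfl, by simp⟩
  | add f g _ _ hf hg =>
    obtain ⟨u, hu, a, ha, h⟩ := hf
    obtain ⟨v, hv, b, hb, h'⟩ := hg
    refine ⟨u + v, add_mem hu hv, a + b, fun hm => by rw [ha hm, hb hm, add_zero], ?_⟩
    rw [← h, ← h', map_add]
    module
  | smul r f _ hf =>
    obtain ⟨u, hu, a, ha, h⟩ := hf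
    refine ⟨r • u, Submodule.smul_mem _ r hu, r * a, fun hm => by rw [ha hm, mul_zero], ?_⟩
    rw [← h, map_smul]
    module

/-! ### Restriction to the leaf -/

lemma constantCoeff_unitCoord (i : Fin k ⊕ Fin k) :
    MvPowerSeries.constantCoeff (unitCoord (k := k) i) = 0 := by
  change PowerSeries.constantCoeff (unitCoord (k := k) i) = 0
  rcases i with i | i <;> simp [unitCoord, rho]

lemma hasSubst_unitCoord : MvPowerSeries.HasSubst (unitCoord (k := k)) :=
  MvPowerSeries.hasSubst_of_constantCoeff_zero constantCoeff_unitCoord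

lemma unitCoord_eq (i : Fin k ⊕ Fin k) :
    unitCoord i = (PowerSeries.X * PowerSeries.C (trigVar i) : LeafFun k) := by
  rcases i with i | i <;> rfl

/-- `onLeaf` as an algebra homomorphism. -/
def onLeafHom (k : ℕ) : CartSeries k →ₐ[ℝ] LeafFun k :=
  MvPowerSeries.substAlgHom (hasSubst_unitCoord (k := k))

lemma onLeafHom_apply (h : CartSeries k) : onLeafHom k h = onLeaf h := by
  rw [onLeafHom, MvPowerSeries.coe_substAlgHom, onLeaf]

lemma onLeaf_add (f g : CartSeries k) : onLeaf (f + g) = onLeaf f + onLeaf g := by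
  simp only [← onLeafHom_apply, map_add]

lemma onLeaf_sub (f g : CartSeries k) : onLeaf (f - g) = onLeaf f - onLeaf g := by
  simp only [← onLeafHom_apply, map_sub]

lemma onLeaf_mul (f g : CartSeries k) : onLeaf (f * g) = onLeaf f * onLeaf g := by
  simp only [← onLeafHom_apply, map_mul]

lemma onLeaf_one : onLeaf (1 : CartSeries k) = 1 := by
  simp only [← onLeafHom_apply, map_one]

lemma onLeaf_sum {ι : Type*} (s : Finset ι) (f : ι → CartSeries k) :
    onLeaf (∑ i ∈ s, f i) = ∑ i ∈ s, onLeaf (f i) := by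
  simp only [← onLeafHom_apply, map_sum]

lemma onLeaf_X (i : Fin k ⊕ Fin k) : onLeaf (MvPowerSeries.X i) = unitCoord i :=
  MvPowerSeries.subst_X hasSubst_unitCoord i

lemma onLeaf_C (r : ℝ) : onLeaf (MvPowerSeries.C r : CartSeries k) = r • 1 := by
  rw [← onLeafHom_apply, MvPowerSeries.c_eq_algebraMap, AlgHom.commutes,
    Algebra.algebraMap_eq_smul_one]

lemma coeff_onLeaf (m : ℕ) (h : CartSeries k) :
    PowerSeries.coeff m (onLeaf h) =
      ∑ d ∈ expsOfDegree (Fin k ⊕ Fin k) m, MvPowerSeries.coeff d h • trigMon d := by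
  have key : ∀ d : Fin k ⊕ Fin k →₀ ℕ, PowerSeries.coeff m
      (d.prod fun i n => (unitCoord i : LeafFun k) ^ n) =
        if d.degree = m then trigMon d else 0 := by
    intro d
    have : (d.prod fun i n => (unitCoord i : LeafFun k) ^ n) =
        PowerSeries.X ^ d.degree * PowerSeries.C (trigMon d) := by
      simp only [Finsupp.prod, unitCoord_eq, mul_pow, Finset.prod_mul_distrib, trigMon, map_prod,
        map_pow, Finset.prod_pow_eq_pow_sum, Finsupp.degree_apply]
    rw [this, PowerSeries.coeff_X_pow_mul', PowerSeries.coeff_C]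
    split_ifs <;> first | rfl | omega
  have h1 : PowerSeries.coeff m (onLeaf h) = _ :=
    MvPowerSeries.coeff_subst hasSubst_unitCoord h (Finsupp.single () m)
  rw [h1]
  change finsum (fun d => MvPowerSeries.coeff d h • PowerSeries.coeff m
    (d.prod fun i n => (unitCoord i : LeafFun k) ^ n)) = _
  simp only [key]
  rw [finsum_eq_sum_of_support_subset (s := expsOfDegree (Fin k ⊕ Fin k) m)]
  · exact Finset.sum_congr rfl fun d hd => by rw [if_pos (mem_expsOfDegree.mp hd)]
  · intro d hd
    rw [mem_coe, mem_expsOfDegree]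
    by_contra hne
    exact hd (by simp [hne])

lemma coeff_onLeaf_gradedOp (t : (Fin k ⊕ Fin k →₀ ℕ) → (Fin k ⊕ Fin k →₀ ℕ) → ℝ) (m : ℕ)
    (F : CartSeries k) :
    PowerSeries.coeff m (onLeaf (gradedOp t F)) =
      ∑ d ∈ expsOfDegree (Fin k ⊕ Fin k) m, MvPowerSeries.coeff d F •
        ∑ e ∈ expsOfDegree (Fin k ⊕ Fin k) m, t d e • trigMon e := by
  simp only [coeff_onLeaf, Finset.smul_sum]
  rw [Finset.sum_comm]
  refine Finset.sum_congr rfl fun e he => ?_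
  rw [coeff_gradedOp, mem_expsOfDegree.mp he, Finset.sum_smul]
  exact Finset.sum_congr rfl fun d _ => by rw [smul_smul]

/-- Linear operators preserving the spaces of homogeneous trigonometric polynomials lift to
degree-preserving operators on power series in the Cartesian variables. -/
lemma exists_gradedOp (T : ℕ → TrigPoly k →ₗ[ℝ] TrigPoly k)
    (hT : ∀ m, ∀ f ∈ homTrig k m, T m f ∈ homTrig k m) :
    ∃ t, ∀ (F : CartSeries k) m, PowerSeries.coeff m (onLeaf (gradedOp t F)) =
      T m (PowerSeries.coeff m (onLeaf F)) := by
  choose t ht using fun d : Fin k ⊕ Fin k →₀ ℕ =>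
    exists_coeffs_of_mem (hT d.degree _ (trigMon_mem d))
  refine ⟨t, fun F m => ?_⟩
  rw [coeff_onLeaf_gradedOp, coeff_onLeaf, map_sum]
  refine Finset.sum_congr rfl fun d hd => ?_
  rw [map_smul, ← mem_expsOfDegree.mp hd, ← ht d]

lemma coeff_euler (m : ℕ) (F : LeafFun k) :
    PowerSeries.coeff m (euler F) = (m : ℝ) • PowerSeries.coeff m F := by
  rcases m with _ | m
  · simp [euler, rho]
  · rw [euler, rho, PowerSeries.coeff_succ_X_mul, PowerSeries.coeff_derivative,
      mul_comm, Nat.cast_smul_eq_nsmul, nsmul_eq_mul]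
    push_cast
    rfl

lemma coeff_dTheta (j : Fin k) (m : ℕ) (F : LeafFun k) :
    PowerSeries.coeff m (dTheta j F) = dTrig j (PowerSeries.coeff m F) := by
  rw [dTheta, PowerSeries.coeff_mk]

lemma exists_gradedOp_euler : ∃ t, ∀ F : CartSeries k,
    onLeaf (gradedOp t F) = euler (onLeaf F) := by
  obtain ⟨t, ht⟩ := exists_gradedOp (k := k) (fun m => (m : ℝ) • LinearMap.id)
    fun m f hf => Submodule.smul_mem _ _ hf
  refine ⟨t, fun F => PowerSeries.ext fun m => ?_⟩
  rw [ht, coeff_euler]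
  rfl

lemma exists_gradedOp_dTheta (j : Fin k) : ∃ t, ∀ F : CartSeries k,
    onLeaf (gradedOp t F) = dTheta j (onLeaf F) := by
  obtain ⟨t, ht⟩ := exists_gradedOp (k := k) (fun _ => (dTrigDer j : TrigPoly k →ₗ[ℝ] TrigPoly k))
    fun m f hf => dTrig_mem j hf
  refine ⟨t, fun F => PowerSeries.ext fun m => ?_⟩
  rw [ht, coeff_dTheta]
  rfl

/-- The homological equation for power series: `t` solves it up to the resonant part given by
`s`, and the resonant part restricts to a power series in `ρ` alone. -/
lemma exists_gradedOp_homological {ω : Fin k → ℝ} (hω : LinearIndependent ℚ ω) :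
    ∃ (t s : (Fin k ⊕ Fin k →₀ ℕ) → (Fin k ⊕ Fin k →₀ ℕ) → ℝ) (a : (Fin k ⊕ Fin k →₀ ℕ) → ℝ),
      (∀ d, Odd d.degree → a d = 0) ∧
      (∀ (F : CartSeries k) m, PowerSeries.coeff m (onLeaf (gradedOp s F)) =
        (∑ d ∈ expsOfDegree (Fin k ⊕ Fin k) m, MvPowerSeries.coeff d F * a d) • 1) ∧
      ∀ F : CartSeries k, ∑ j, ω j • dTheta j (onLeaf (gradedOp t F)) + onLeaf (gradedOp s F) =
        onLeaf F := by
  choose u hu a ha h using fun d : Fin k ⊕ Fin k →₀ ℕ => exists_homological hω (trigMon_mem d)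
  choose t ht using fun d : Fin k ⊕ Fin k →₀ ℕ => exists_coeffs_of_mem (hu d)
  have hmem : ∀ d : Fin k ⊕ Fin k →₀ ℕ, a d • (1 : TrigPoly k) ∈ homTrig k d.degree := fun d => by
    rw [eq_sub_of_add_eq' (h d)]
    exact sub_mem (trigMon_mem d) (rotDer_mem ω (hu d))
  choose s hs using fun d : Fin k ⊕ Fin k →₀ ℕ => exists_coeffs_of_mem (hmem d)
  have hcs : ∀ (F : CartSeries k) m, PowerSeries.coeff m (onLeaf (gradedOp s F)) =
      (∑ d ∈ expsOfDegree (Fin k ⊕ Fin k) m, MvPowerSeries.coeff d F * a d) • 1 := by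
    intro F m
    rw [coeff_onLeaf_gradedOp, Finset.sum_smul]
    refine Finset.sum_congr rfl fun d hd => ?_
    rw [← mem_expsOfDegree.mp hd, ← hs d, smul_smul]
  refine ⟨t, s, a, ha, hcs, fun F => PowerSeries.ext fun m => ?_⟩
  have hrot : PowerSeries.coeff m (∑ j, ω j • dTheta j (onLeaf (gradedOp t F))) =
      rotDer ω (PowerSeries.coeff m (onLeaf (gradedOp t F))) := by
    rw [rotDer_apply, map_sum]
    refine Finset.sum_congr rfl fun j _ => ?_
    rw [← coeff_dTheta]
    rfl
  rw [map_add, hrot, hcs, coeff_onLeaf_gradedOp, coeff_onLeaf, map_sum, Finset.sum_smul,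
    ← Finset.sum_add_distrib]
  refine Finset.sum_congr rfl fun d hd => ?_
  rw [map_smul, ← smul_smul, ← smul_add, ← mem_expsOfDegree.mp hd, ← ht d, h d]

/-! ### Euler field and angular derivatives on the leaf -/

lemma dTrig_smul (j : Fin k) (r : ℝ) (f : TrigPoly k) : dTrig j (r • f) = r • dTrig j f :=
  (dTrigDer j).map_smul r f

lemma dTheta_one_add (j : Fin k) (F : LeafFun k) : dTheta j (1 + F) = dTheta j F := by
  refine PowerSeries.ext fun m => ?_
  rw [coeff_dTheta, coeff_dTheta, map_add, ← dTrigDer_apply, map_add, PowerSeries.coeff_one]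
  split_ifs <;> simp [← dTrigDer_apply]

lemma dTheta_rho_mul (j : Fin k) (F : LeafFun k) : dTheta j (rho * F) = rho * dTheta j F := by
  refine PowerSeries.ext fun m => ?_
  rw [coeff_dTheta]
  rcases m with _ | m
  · simp [rho, ← dTrigDer_apply]
  · rw [rho, PowerSeries.coeff_succ_X_mul, PowerSeries.coeff_succ_X_mul, coeff_dTheta]

lemma dTheta_C (j : Fin k) (f : TrigPoly k) :
    dTheta j (PowerSeries.C f) = PowerSeries.C (dTrig j f) := by
  refine PowerSeries.ext fun m => ?_
  rw [coeff_dTheta, PowerSeries.coeff_C, PowerSeries.coeff_C]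
  split_ifs <;> simp [← dTrigDer_apply]

lemma euler_one_add (F : LeafFun k) : euler (1 + F) = euler F := by
  simp [euler]

lemma euler_rho_mul (F : LeafFun k) : euler (rho * F) = rho * (F + euler F) := by
  simp only [euler, rho, Derivation.leibniz, smul_eq_mul, PowerSeries.derivative_X]
  ring

lemma euler_C (f : TrigPoly k) : euler (PowerSeries.C f) = 0 := by
  simp [euler]

/-! ### Changes of variables in Cartesian coordinates -/

/-- The Cartesian coordinates of the point with polar coordinates `(1 + U) ρ`, `θ_j + Q_j`, in
units in which all radii are `ρ`, as power series in the new Cartesian coordinates. -/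
def newCoord (u : CartSeries k) (q : Fin k → CartSeries k) : Fin k ⊕ Fin k → CartSeries k :=
  Sum.elim
    (fun j => (MvPowerSeries.X (Sum.inl j) * (PowerSeries.cos ℝ).subst (q j) -
      MvPowerSeries.X (Sum.inr j) * (PowerSeries.sin ℝ).subst (q j)) * (1 + u))
    (fun j => (MvPowerSeries.X (Sum.inr j) * (PowerSeries.cos ℝ).subst (q j) +
      MvPowerSeries.X (Sum.inl j) * (PowerSeries.sin ℝ).subst (q j)) * (1 + u))

lemma constantCoeff_newCoord (u : CartSeries k) (q : Fin k → CartSeries k) (i : Fin k ⊕ Fin k) :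
    MvPowerSeries.constantCoeff (newCoord u q i) = 0 := by
  rcases i with i | i <;> simp [newCoord]

lemma onLeaf_subst {q : CartSeries k} (hq : MvPowerSeries.constantCoeff q = 0) (f : PowerSeries ℝ) :
    onLeaf (f.subst q) = f.subst (onLeaf q) :=
  MvPowerSeries.subst_comp_subst_apply (PowerSeries.HasSubst.of_constantCoeff_zero hq).const
    hasSubst_unitCoord f

lemma NearIdentity.pull_eq_onLeaf (φ : NearIdentity k) (h : CartSeries k) :
    φ.pull h = onLeaf (MvPowerSeries.subst (newCoord φ.u φ.q) h) := by
  rw [onLeaf, MvPowerSeries.subst_comp_subst_apply (MvPowerSeries.hasSubst_of_constantCoeff_zero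
    (constantCoeff_newCoord φ.u φ.q)) hasSubst_unitCoord, NearIdentity.pull]
  congr 1
  funext i
  change _ = onLeaf (newCoord φ.u φ.q i)
  rcases i with i | i
  · simp only [newCoord, Sum.elim_inl, onLeaf_mul, onLeaf_sub, onLeaf_add, onLeaf_one, onLeaf_X,
      onLeaf_subst (φ.q_zero i), NearIdentity.newRho, NearIdentity.newCos, NearIdentity.shift,
      unitCoord, Sum.elim_inr]
    ring
  · simp only [newCoord, Sum.elim_inl, onLeaf_mul, onLeaf_add, onLeaf_one, onLeaf_X,
      onLeaf_subst (φ.q_zero i), NearIdentity.newRho, NearIdentity.newSin, NearIdentity.shift,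
      unitCoord, Sum.elim_inr]
    ring

/-- A change of variables known up to degree `m` determines compositions up to degree `m + 1`. -/
protected lemma EqBelow.subst_newCoord {m : ℕ} {u u' : CartSeries k} {q q' : Fin k → CartSeries k}
    (hq : ∀ j, MvPowerSeries.constantCoeff (q j) = 0)
    (hq' : ∀ j, MvPowerSeries.constantCoeff (q' j) = 0) (h : EqBelow m u u')
    (h' : ∀ j, EqBelow m (q j) (q' j)) (f : CartSeries k) :
    EqBelow (m + 1) (MvPowerSeries.subst (newCoord u q) f)
      (MvPowerSeries.subst (newCoord u' q') f) := by
  refine EqBelow.subst (constantCoeff_newCoord _ _) (constantCoeff_newCoord _ _) (fun i => ?_) f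
  have hs : ∀ (p : PowerSeries ℝ) j, EqBelow m (p.subst (q j)) (p.subst (q' j)) := fun p j =>
    EqBelow.subst (fun _ => hq j) (fun _ => hq' j) (fun _ => h' j) p
  have hX : ∀ (p : PowerSeries ℝ) i j, EqBelow (m + 1) (MvPowerSeries.X i * p.subst (q j))
      (MvPowerSeries.X i * p.subst (q' j)) := fun p i j =>
    EqBelow.mul_succ (EqBelow.refl _ _) (by simp) (by simp) (hs p j)
  rcases i with j | j
  · exact EqBelow.mul_succ ((hX _ _ _).sub (hX _ _ _)) (by simp) (by simp)
      ((EqBelow.refl _ _).add h)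
  · exact EqBelow.mul_succ ((hX _ _ _).add (hX _ _ _)) (by simp) (by simp)
      ((EqBelow.refl _ _).add h)

protected lemma Filtered.subst_newCoord {P : Type*} {A : ℕ → Subalgebra ℝ (P → ℝ)} (hA : Monotone A)
    {u : P → CartSeries k} {q : Fin k → P → CartSeries k}
    (hq : ∀ j s, MvPowerSeries.constantCoeff (q j s) = 0) (hu : Filtered A u)
    (hqA : ∀ j, Filtered A (q j)) {f : P → CartSeries k} (hf : Filtered A f) :
    Filtered A fun s => MvPowerSeries.subst (newCoord (u s) fun j => q j s) (f s) := by
  refine Filtered.subst hA (a := fun i s => newCoord (u s) (fun j => q j s) i)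
    (fun i s => constantCoeff_newCoord _ _ i) (fun i => ?_) hf
  have hX : ∀ (p : PowerSeries ℝ) i j,
      Filtered A fun s => MvPowerSeries.X i * p.subst (q j s) := fun p i j =>
    (Filtered.const _).mul hA (Filtered.subst hA (a := fun (_ : Unit) s => q j s)
      (fun _ s => hq j s) (fun _ => hqA j) (Filtered.const p))
  rcases i with j | j
  · exact ((hX _ _ _).sub (hX _ _ _)).mul hA ((Filtered.const _).add hu)
  · exact ((hX _ _ _).add (hX _ _ _)).mul hA ((Filtered.const _).add hu)

/-! ### The normal form equation -/

/-- The right-hand side of the equation `∑ⱼ ω_j ∂q/∂θ_j + W = N` for a normalizing change of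
variables `q` and a normal form `ω + W`, in terms of `N`; here `q = T N`, `W = S N`, the components
`none` and `some j` are the radial and the angular ones, `E` and `D j` are the matrices of
`ρ ∂/∂ρ` and `∂/∂θ_j`, and `h` is the given vector field without its linear part. -/
def normalFormRHS (T S E : (Fin k ⊕ Fin k →₀ ℕ) → (Fin k ⊕ Fin k →₀ ℕ) → ℝ)
    (D : Fin k → (Fin k ⊕ Fin k →₀ ℕ) → (Fin k ⊕ Fin k →₀ ℕ) → ℝ)
    (h N : Option (Fin k) → CartSeries k) (o : Option (Fin k)) : CartSeries k :=
  MvPowerSeries.subst (newCoord (gradedOp T (N none)) fun j => gradedOp T (N (some j))) (h o) *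
      (1 + o.elim (gradedOp T (N none)) fun _ => 0) -
    gradedOp S (N none) * (o.elim (gradedOp T (N none)) fun _ => 0) -
    gradedOp S (N none) * gradedOp E (gradedOp T (N o)) -
    ∑ j, gradedOp S (N (some j)) * gradedOp (D j) (gradedOp T (N o))

section NormalFormRHS

variable (T S E : (Fin k ⊕ Fin k →₀ ℕ) → (Fin k ⊕ Fin k →₀ ℕ) → ℝ)
  (D : Fin k → (Fin k ⊕ Fin k →₀ ℕ) → (Fin k ⊕ Fin k →₀ ℕ) → ℝ)

lemma constantCoeff_normalFormRHS {h : Option (Fin k) → CartSeries k}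
    (hh : ∀ o, MvPowerSeries.constantCoeff (h o) = 0) {N : Option (Fin k) → CartSeries k}
    (hN : ∀ o, MvPowerSeries.constantCoeff (N o) = 0) (o : Option (Fin k)) :
    MvPowerSeries.constantCoeff (normalFormRHS T S E D h N o) = 0 := by
  have hpull := MvPowerSeries.constantCoeff_subst_eq_zero
    (MvPowerSeries.hasSubst_of_constantCoeff_zero (constantCoeff_newCoord (gradedOp T (N none))
      fun j => gradedOp T (N (some j)))) (constantCoeff_newCoord _ _) (hh o)
  simp only [normalFormRHS, map_sub, map_mul, map_sum, hpull, constantCoeff_gradedOp S (hN _)]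
  simp

protected lemma EqBelow.normalFormRHS {h : Option (Fin k) → CartSeries k}
    (hh : ∀ o, MvPowerSeries.constantCoeff (h o) = 0) {m : ℕ}
    {N N' : Option (Fin k) → CartSeries k}
    (hN : ∀ o, MvPowerSeries.constantCoeff (N o) = 0)
    (hN' : ∀ o, MvPowerSeries.constantCoeff (N' o) = 0)
    (hNN : ∀ o, EqBelow m (N o) (N' o)) (o : Option (Fin k)) :
    EqBelow (m + 1) (normalFormRHS T S E D h N o) (normalFormRHS T S E D h N' o) := by
  have c0 : ∀ t {N : Option (Fin k) → CartSeries k},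
      (∀ o, MvPowerSeries.constantCoeff (N o) = 0) → ∀ o,
      MvPowerSeries.constantCoeff (gradedOp t (N o)) = 0 :=
    fun t _ hN o => constantCoeff_gradedOp t (hN o)
  have e0 : ∀ t o, EqBelow m (gradedOp t (N o)) (gradedOp t (N' o)) := fun t o =>
    (hNN o).gradedOp t
  have hpull0 : ∀ M : Option (Fin k) → CartSeries k, MvPowerSeries.constantCoeff
      (MvPowerSeries.subst (newCoord (gradedOp T (M none)) fun j => gradedOp T (M (some j)))
        (h o)) = 0 := fun M => MvPowerSeries.constantCoeff_subst_eq_zero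
    (MvPowerSeries.hasSubst_of_constantCoeff_zero (constantCoeff_newCoord _ _))
    (constantCoeff_newCoord _ _) (hh o)
  have hr : EqBelow m (o.elim (gradedOp T (N none)) fun _ => 0)
      (o.elim (gradedOp T (N' none)) fun _ => 0) := by
    cases o
    · exact e0 T none
    · exact EqBelow.refl _ _
  have hr0 : ∀ {M : Option (Fin k) → CartSeries k},
      (∀ o, MvPowerSeries.constantCoeff (M o) = 0) →
      MvPowerSeries.constantCoeff (o.elim (gradedOp T (M none)) fun _ => 0) = 0 := by
    intro M hM
    cases o
    · exact c0 T hM none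
    · exact map_zero _
  refine (((EqBelow.mul_succ (EqBelow.subst_newCoord (fun j => c0 T hN _) (fun j => c0 T hN' _)
    (e0 T none) (fun j => e0 T (some j)) (h o)) (hpull0 N) (hpull0 N')
    ((EqBelow.refl _ _).add hr)).sub ?_).sub ?_).sub (EqBelow.sum fun j _ => ?_)
  · exact (e0 S none).mul_gain (c0 S hN _) (c0 S hN' _) hr (hr0 hN) (hr0 hN')
  · exact (e0 S none).mul_gain (c0 S hN _) (c0 S hN' _) ((e0 T o).gradedOp E)
      (constantCoeff_gradedOp E (c0 T hN o)) (constantCoeff_gradedOp E (c0 T hN' o))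
  · exact (e0 S (some j)).mul_gain (c0 S hN _) (c0 S hN' _) ((e0 T o).gradedOp (D j))
      (constantCoeff_gradedOp (D j) (c0 T hN o)) (constantCoeff_gradedOp (D j) (c0 T hN' o))

protected lemma Filtered.normalFormRHS {P : Type*} {A : ℕ → Subalgebra ℝ (P → ℝ)} (hA : Monotone A)
    {h N : P → Option (Fin k) → CartSeries k}
    (hh : ∀ o, Filtered A fun s => h s o)
    (hN0 : ∀ s o, MvPowerSeries.constantCoeff (N s o) = 0)
    (hN : ∀ o, Filtered A fun s => N s o) (o : Option (Fin k)) :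
    Filtered A fun s => normalFormRHS T S E D (h s) (N s) o := by
  have hr : Filtered A fun s => o.elim (gradedOp T (N s none)) fun _ => 0 := by
    cases o
    · exact (hN none).gradedOp T
    · exact Filtered.const _
  refine (((((Filtered.subst_newCoord hA (u := fun s => gradedOp T (N s none))
    (q := fun j s => gradedOp T (N s (some j)))
    (fun j s => constantCoeff_gradedOp T (hN0 s _)) ((hN none).gradedOp T)
    (fun j => (hN (some j)).gradedOp T) (hh o)).mul hA ((Filtered.const _).add hr)).sub
    (((hN none).gradedOp S).mul hA hr)).sub
    (((hN none).gradedOp S).mul hA (((hN o).gradedOp T).gradedOp E)))).sub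
    (Filtered.sum fun j _ => ((hN (some j)).gradedOp S).mul hA (((hN o).gradedOp T).gradedOp (D j)))

end NormalFormRHS

/-! ### Polynomial dependence on the coefficients -/

/-- The functions of the coefficients that are polynomials in those of degree at most `m`. -/
def polyFunctions (k m : ℕ) : Subalgebra ℝ ((CoeffIdx k → ℝ) → ℝ) :=
  (MvPolynomial.supported ℝ {i : CoeffIdx k | i.1.degree ≤ m}).map
    (AlgHom.pi fun x => MvPolynomial.aeval x)

lemma polyFunctions_mono : Monotone (polyFunctions k) := fun _ _ hm =>
  Subalgebra.map_mono (MvPolynomial.supported_mono fun _ hi => le_trans hi hm)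

lemma exists_polynomial_of_mem_polyFunctions {m : ℕ} {F : (CoeffIdx k → ℝ) → ℝ}
    (hF : F ∈ polyFunctions k m) : ∃ p : MvPolynomial (CoeffIdx k) ℝ,
      (∀ i ∈ p.vars, i.1.degree ≤ m) ∧ ∀ x, F x = MvPolynomial.eval x p := by
  obtain ⟨p, hp, rfl⟩ := Subalgebra.mem_map.mp hF
  refine ⟨p, fun i hi => MvPolynomial.mem_supported.mp hp hi, fun x => ?_⟩
  simp [MvPolynomial.aeval_eq_eval]

/-- The power series without constant term with prescribed coefficients. -/
def coeffSeries (x : CoeffIdx k → ℝ) (o : Option (Fin k)) : CartSeries k :=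
  open Classical in fun d => if d = 0 then 0 else x (d, o)

open Classical in
lemma coeff_coeffSeries (x : CoeffIdx k → ℝ) (o : Option (Fin k)) (d : Fin k ⊕ Fin k →₀ ℕ) :
    MvPowerSeries.coeff d (coeffSeries x o) = if d = 0 then 0 else x (d, o) := rfl

lemma constantCoeff_coeffSeries (x : CoeffIdx k → ℝ) (o : Option (Fin k)) :
    MvPowerSeries.constantCoeff (coeffSeries x o) = 0 := by
  rw [← MvPowerSeries.coeff_zero_eq_constantCoeff_apply, coeff_coeffSeries, if_pos rfl]

lemma filtered_coeffSeries (o : Option (Fin k)) :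
    Filtered (polyFunctions k) fun x => coeffSeries x o := by
  intro d
  by_cases hd : d = 0
  · subst hd
    simp only [MvPowerSeries.coeff_zero_eq_constantCoeff_apply, constantCoeff_coeffSeries]
    exact zero_mem _
  · refine Subalgebra.mem_map.mpr ⟨MvPolynomial.X (d, o), ?_, ?_⟩
    · exact MvPolynomial.X_mem_supported.mpr (le_refl d.degree)
    · funext x
      simp [coeff_coeffSeries, hd]

/-- Solutions of the normal form equation, with coefficients of degree `m` that are polynomials in
the coefficients of degree at most `m` of the given vector field. -/
lemma exists_filtered_solution (T S E : (Fin k ⊕ Fin k →₀ ℕ) → (Fin k ⊕ Fin k →₀ ℕ) → ℝ)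
    (D : Fin k → (Fin k ⊕ Fin k →₀ ℕ) → (Fin k ⊕ Fin k →₀ ℕ) → ℝ) :
    ∃ N : (CoeffIdx k → ℝ) → Option (Fin k) → CartSeries k,
      (∀ x, normalFormRHS T S E D (coeffSeries x) (N x) = N x) ∧
      (∀ x o, MvPowerSeries.constantCoeff (N x o) = 0) ∧
      ∀ o, Filtered (polyFunctions k) fun x => N x o := by
  choose N hN hN0 hNn using fun x : CoeffIdx k → ℝ =>
    exists_fixedPoint (normalFormRHS T S E D (coeffSeries x))
      (fun Z hZ => constantCoeff_normalFormRHS T S E D (constantCoeff_coeffSeries x) hZ)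
      (fun m Z Z' hZ hZ' h => EqBelow.normalFormRHS T S E D (constantCoeff_coeffSeries x) hZ hZ' h)
  refine ⟨N, hN, hN0, fun o d => ?_⟩
  have hiter : ∀ n, (∀ x o, MvPowerSeries.constantCoeff
      ((normalFormRHS T S E D (coeffSeries x))^[n] 0 o) = 0) ∧
      ∀ o, Filtered (polyFunctions k) fun x =>
        (normalFormRHS T S E D (coeffSeries x))^[n] 0 o := by
    intro n
    induction n with
    | zero => exact ⟨fun x o => map_zero _, fun o => Filtered.const 0⟩
    | succ n ih =>
      simp only [Function.iterate_succ_apply']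
      exact ⟨fun x => constantCoeff_normalFormRHS T S E D (constantCoeff_coeffSeries x) (ih.1 x),
        Filtered.normalFormRHS T S E D polyFunctions_mono filtered_coeffSeries ih.1 ih.2⟩
  simp only [hNn _ (d.degree + 1) o d (Nat.lt_succ_self _)]
  exact (hiter (d.degree + 1)).2 o d

/-- Solutions of the normal form equation give near-identity changes of variables transforming the
vector field into its normal form. -/
lemma transforms_of_solution {ω : Fin k → ℝ}
    {T S E : (Fin k ⊕ Fin k →₀ ℕ) → (Fin k ⊕ Fin k →₀ ℕ) → ℝ}
    {D : Fin k → (Fin k ⊕ Fin k →₀ ℕ) → (Fin k ⊕ Fin k →₀ ℕ) → ℝ}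
    (hE : ∀ F : CartSeries k, onLeaf (gradedOp E F) = euler (onLeaf F))
    (hD : ∀ j, ∀ F : CartSeries k, onLeaf (gradedOp (D j) F) = dTheta j (onLeaf F))
    (hTS : ∀ F : CartSeries k, ∑ j, ω j • dTheta j (onLeaf (gradedOp T F)) +
      onLeaf (gradedOp S F) = onLeaf F)
    {h N : Option (Fin k) → CartSeries k} (hN : normalFormRHS T S E D h N = N)
    (φ : NearIdentity k) (hu : φ.u = gradedOp T (N none))
    (hq : ∀ j, φ.q j = gradedOp T (N (some j))) :
    φ.Transforms ⟨h none, fun j => MvPowerSeries.C (ω j) + h (some j)⟩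
      ⟨gradedOp S (N none), fun j => MvPowerSeries.C (ω j) + gradedOp S (N (some j))⟩ := by
  have hφ : newCoord φ.u φ.q =
      newCoord (gradedOp T (N none)) fun j => gradedOp T (N (some j)) := by
    rw [hu, funext hq]
  have hpull : ∀ f, onLeaf (MvPowerSeries.subst (newCoord (gradedOp T (N none))
      fun j => gradedOp T (N (some j))) f) = φ.pull f := fun f => by
    rw [φ.pull_eq_onLeaf, hφ]
  -- The fixed point equation holds for series in Cartesian coordinates; only its restriction to
  -- the leaf can be combined with the homological equation.
  have key : ∀ o, _ := fun o => (hTS (N o)).trans (congrArg onLeaf (congrFun hN o).symm)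
  simp only [normalFormRHS, onLeaf_sub, onLeaf_mul, onLeaf_add, onLeaf_one, onLeaf_sum, hE, hD,
    hpull] at key
  have hang : ∀ F : LeafFun k, ∑ j, onLeaf (MvPowerSeries.C (ω j) + gradedOp S (N (some j))) *
      dTheta j F = ∑ j, ω j • dTheta j F + ∑ j, onLeaf (gradedOp S (N (some j))) * dTheta j F := by
    intro F
    rw [← Finset.sum_add_distrib]
    refine Finset.sum_congr rfl fun j _ => ?_
    rw [onLeaf_add, onLeaf_C, add_mul, smul_one_mul]
  constructor
  · have h1 := key none
    simp only [Option.elim_none] at h1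
    simp only [LeafField.apply, NearIdentity.newRho, euler_rho_mul, dTheta_rho_mul,
      euler_one_add, dTheta_one_add, hu]
    simp only [mul_left_comm _ (rho : LeafFun k), ← Finset.mul_sum, hang]
    linear_combination (rho : LeafFun k) * h1
  · intro i
    have h1 := key (some i)
    simp only [Option.elim_some] at h1
    have hz : onLeaf (0 : CartSeries k) = 0 := by rw [← onLeafHom_apply, map_zero]
    have hpC : φ.pull (MvPowerSeries.C (ω i) + h (some i)) = ω i • 1 + φ.pull (h (some i)) := by
      have hs := MvPowerSeries.hasSubst_of_constantCoeff_zero (constantCoeff_newCoord φ.u φ.q)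
      rw [φ.pull_eq_onLeaf, φ.pull_eq_onLeaf, MvPowerSeries.subst_add hs, onLeaf_add,
        MvPowerSeries.subst_C, onLeaf_C]
    simp only [LeafField.apply, NearIdentity.shift, hang, hpC, hq]
    rw [onLeaf_add, onLeaf_C]
    rw [hz] at h1
    linear_combination h1

/-! ### Vector fields in normal form -/

lemma sum_cartCoord_sq {n : ℕ} (hk : 0 < k) (hkn : k ≤ n) (σ : Equiv.Perm (Fin n))
    (c : Fin n → ℝ) (hc : c (cellIdx hkn σ (lastIdx hk)) ≠ 0) :
    cartCoord hk hkn σ c (0, lastIdx hk) ^ 2 + cartCoord hk hkn σ c (1, lastIdx hk) ^ 2 =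
      PowerSeries.X ^ 2 := by
  have h1 : (cosT (lastIdx hk) ^ 2 + sinT (lastIdx hk) ^ 2 : TrigPoly k) = 1 := by
    ext θ
    exact Real.cos_sq_add_sin_sq _
  have h2 := congrArg (PowerSeries.C (R := TrigPoly k)) h1
  simp only [map_add, map_pow, map_one] at h2
  simp only [cartCoord, div_self hc, one_smul, Matrix.cons_val_zero, Matrix.cons_val_one,
    unitCoord, Sum.elim_inl, Sum.elim_inr, rho]
  linear_combination PowerSeries.X ^ 2 * h2

lemma rotScale_eq (a b : ℝ) : rotScale a b = !![a, -b; b, a] := by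
  have hn : Real.sqrt (a ^ 2 + b ^ 2) = ‖(⟨a, b⟩ : ℂ)‖ := by
    rw [Complex.norm_def, Complex.normSq_mk]; congr 1; ring
  have hc : Real.sqrt (a ^ 2 + b ^ 2) * Real.cos (Complex.arg ⟨a, b⟩) = a := by
    rw [hn, Complex.norm_mul_cos_arg]
  have hs : Real.sqrt (a ^ 2 + b ^ 2) * Real.sin (Complex.arg ⟨a, b⟩) = b := by
    rw [hn, Complex.norm_mul_sin_arg]
  rw [rotScale, rotation]
  ext i j
  fin_cases i <;> fin_cases j <;> simp [hc, hs]

lemma C_smul (r : ℝ) (f : TrigPoly k) :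
    PowerSeries.C (r • f) = (r • PowerSeries.C f : LeafFun k) := by
  refine PowerSeries.ext fun m => ?_
  rw [PowerSeries.coeff_smul, PowerSeries.coeff_C, PowerSeries.coeff_C]
  split_ifs <;> simp

lemma isNormalForm_of_onLeaf {n : ℕ} (hk : 0 < k) (hkn : k ≤ n) (σ : Equiv.Perm (Fin n))
    (c : Fin n → ℝ) (hc : c (cellIdx hkn σ (lastIdx hk)) ≠ 0) (a : ℕ → ℝ) (b : Fin k → ℕ → ℝ)
    (w : LeafField k)
    (hr : onLeaf w.radial = (PowerSeries.mk a).subst (PowerSeries.X ^ 2 : LeafFun k))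
    (ha : ∀ j, onLeaf (w.angular j) =
      (PowerSeries.mk (b j)).subst (PowerSeries.X ^ 2 : LeafFun k)) :
    IsNormalForm hk hkn σ c a b w := by
  rintro ⟨e, j⟩
  -- `x² + y² = ρ²` in the last plane, since its ratio of radii is `1`.
  rw [sum_cartCoord_sq hk hkn σ c hc]
  have hX : PowerSeries.HasSubst (PowerSeries.X ^ 2 : LeafFun k) :=
    PowerSeries.HasSubst.X_pow two_ne_zero
  have h0 : (PowerSeries.mk fun _ => (0 : ℝ)).subst (PowerSeries.X ^ 2 : LeafFun k) = 0 := by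
    rw [← PowerSeries.coe_substAlgHom hX]
    exact map_zero _
  have hneg : (PowerSeries.mk fun p => -b j p).subst (PowerSeries.X ^ 2 : LeafFun k) =
      (-((PowerSeries.mk (b j)).subst (PowerSeries.X ^ 2 : LeafFun k) : LeafFun k) :
        LeafFun k) := by
    rw [← PowerSeries.coe_substAlgHom hX]
    exact map_neg (PowerSeries.substAlgHom hX) (PowerSeries.mk (b j))
  have hentry : ∀ e' j', (PowerSeries.mk fun p => blockMatrix a b p (e, j) (e', j')).subst
      (PowerSeries.X ^ 2 : LeafFun k) = if j = j' then
        (PowerSeries.mk fun p => rotScale (a p) (b j p) e e').subst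
          (PowerSeries.X ^ 2 : LeafFun k) else 0 := by
    intro e' j'
    simp only [blockMatrix, Matrix.blockDiagonal_apply]
    split_ifs with h
    · rfl
    · exact h0
  have hcoord : ∀ e', cartCoord hk hkn σ c (e', j) =
      rho * PowerSeries.C ((c (cellIdx hkn σ j) / c (cellIdx hkn σ (lastIdx hk))) •
        (![cosT j, sinT j] e')) := by
    intro e'
    rw [C_smul, mul_smul_comm]
    fin_cases e' <;> rfl
  simp only [Fintype.sum_prod_type, Fin.sum_univ_two, hentry, ite_mul, zero_mul, Finset.sum_ite_eq,
    Finset.mem_univ, if_true, LeafField.apply, hr, ha, hcoord, euler_rho_mul, euler_C,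
    dTheta_rho_mul, dTheta_C, dTrig_smul, rotScale_eq]
  fin_cases e
  · simp [dTrig_cosT, hneg, C_smul, apply_ite]
    have hsign : ∀ (β r s : LeafFun k) (x : ℝ), β * (r * -(x • s)) = x • (-β * (r * s)) := by
      intro β r s x
      simp only [Algebra.smul_def]
      ring
    exact hsign _ _ _ _
  · simp [dTrig_sinT, C_smul, apply_ite, add_comm]

end LeafNF

end

open LeafNF in
theorem mainTheorem3 {k n : ℕ} (hk : 0 < k) (hkn : k ≤ n)
    (σ : Equiv.Perm (Fin n)) (hσ : σ ∈ LeafNF.cellPerms k n)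
    (ω : Fin n → ℝ)
    (hω : LinearIndependent ℚ fun j : Fin k => ω (LeafNF.cellIdx hkn σ j))
    (c : Fin n → ℝ) (hc : c ∈ LeafNF.leafParams hkn σ) :
    ∃ (A : ℕ → MvPolynomial (LeafNF.CoeffIdx k) ℝ)
      (B : Fin k → ℕ → MvPolynomial (LeafNF.CoeffIdx k) ℝ),
      (∀ p, (∀ s ∈ (A p).vars, s.1.degree ≤ 2 * p) ∧
        ∀ j, ∀ s ∈ (B j p).vars, s.1.degree ≤ 2 * p) ∧
      ∀ (g : MvPowerSeries (Fin n ⊕ Fin n) ℝ) (f : Fin n → MvPowerSeries (Fin n ⊕ Fin n) ℝ),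
        MvPowerSeries.constantCoeff g = 0 → (∀ i, MvPowerSeries.constantCoeff (f i) = 0) →
        ∃ (a : ℕ → ℝ) (b : Fin k → ℕ → ℝ),
          (∀ p, a p = MvPolynomial.eval (LeafNF.reducedCoeff hk hkn σ c g f) (A p)) ∧
          (∀ j p, b j p = MvPolynomial.eval (LeafNF.reducedCoeff hk hkn σ c g f) (B j p)) ∧
          a 0 = 0 ∧ (∀ j, b j 0 = ω (LeafNF.cellIdx hkn σ j)) ∧
          ∃ (φ : LeafNF.NearIdentity k) (w : LeafNF.LeafField k),
            φ.Transforms (LeafNF.leafReduction hk hkn σ c ω g f) w ∧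
            LeafNF.IsNormalForm hk hkn σ c a b w := by
  obtain ⟨T, S, mean, hodd, hS, hTS⟩ := exists_gradedOp_homological hω
  obtain ⟨E, hE⟩ := exists_gradedOp_euler (k := k)
  choose D hD using exists_gradedOp_dTheta (k := k)
  obtain ⟨N, hN, hN0, hNA⟩ := exists_filtered_solution T S E D
  -- `r o m x` is the coefficient of `ρ ^ m` in the resonant part of the solution; the normal form
  -- collects the even `m`.
  let r : Option (Fin k) → ℕ → (CoeffIdx k → ℝ) → ℝ := fun o m x =>
    ∑ d ∈ expsOfDegree (Fin k ⊕ Fin k) m, MvPowerSeries.coeff d (N x o) * mean d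
  have hr : ∀ o m, r o m ∈ polyFunctions k m := by
    intro o m
    have : r o m = ∑ d ∈ expsOfDegree (Fin k ⊕ Fin k) m,
        mean d • fun x => MvPowerSeries.coeff d (N x o) := by
      funext x
      simp [r, mul_comm]
    rw [this]
    refine sum_mem fun d hd => Subalgebra.smul_mem _ ?_ _
    have := hNA o d
    rwa [mem_expsOfDegree.mp hd] at this
  have hr0 : ∀ o x, r o 0 x = 0 := by
    intro o x
    refine Finset.sum_eq_zero fun d hd => ?_
    rw [(Finsupp.degree_eq_zero_iff d).mp (by simpa using hd),
      MvPowerSeries.coeff_zero_eq_constantCoeff_apply, hN0, zero_mul]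
  have hrodd : ∀ o m x, Odd m → r o m x = 0 := by
    intro o m x hm
    refine Finset.sum_eq_zero fun d hd => ?_
    rw [hodd d (by rwa [mem_expsOfDegree.mp hd]), mul_zero]
  have hrS : ∀ o x, onLeaf (gradedOp S (N x o)) =
      (PowerSeries.mk fun p => r o (2 * p) x).subst (PowerSeries.X ^ 2 : LeafFun k) := by
    intro o x
    refine PowerSeries.ext fun m => ?_
    rw [hS, PowerSeries.coeff_subst_X_pow two_ne_zero, PowerSeries.coeff_mk,
      Algebra.algebraMap_eq_smul_one]
    split_ifs with h
    · rw [Nat.mul_div_cancel' h]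
    · refine (congrArg (· • (1 : TrigPoly k))
        (hrodd o m x (Nat.not_even_iff_odd.mp fun h' => h h'.two_dvd))).trans (zero_smul ℝ _)
  choose A hA hAr using fun o p => exists_polynomial_of_mem_polyFunctions (hr o (2 * p))
  refine ⟨A none, fun j p => MvPolynomial.C (if p = 0 then ω (cellIdx hkn σ j) else 0) +
    A (some j) p, fun p => ⟨hA none p, fun j i hi => ?_⟩, fun g f hg hf => ?_⟩
  · classical
    have := MvPolynomial.vars_add_subset _ _ hi
    rw [MvPolynomial.vars_C, Finset.empty_union] at this
    exact hA (some j) p i this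
  set x := reducedCoeff hk hkn σ c g f
  have hred0 : ∀ h : MvPowerSeries (Fin n ⊕ Fin n) ℝ, MvPowerSeries.constantCoeff h = 0 →
      MvPowerSeries.coeff 0 (reduced hk hkn σ c h) = 0 := by
    intro h h0
    have : MvPowerSeries.coeff 0 (reduced hk hkn σ c h) = _ * MvPowerSeries.coeff
      (Finsupp.mapDomain (Sum.map (cellIdx hkn σ) (cellIdx hkn σ)) 0) h := rfl
    rw [this, Finsupp.mapDomain_zero, MvPowerSeries.coeff_zero_eq_constantCoeff_apply, h0,
      mul_zero]
  have hnone : coeffSeries x none = reduced hk hkn σ c g := by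
    refine MvPowerSeries.ext fun d => ?_
    rw [coeff_coeffSeries]
    split_ifs with hd
    · rw [hd, hred0 g hg]
    · rfl
  have hsome : ∀ j, coeffSeries x (some j) = reduced hk hkn σ c (f (cellIdx hkn σ j)) := by
    intro j
    refine MvPowerSeries.ext fun d => ?_
    rw [coeff_coeffSeries]
    split_ifs with hd
    · rw [hd, hred0 _ (hf _)]
    · rfl
  refine ⟨fun p => r none (2 * p) x,
    fun j p => (if p = 0 then ω (cellIdx hkn σ j) else 0) + r (some j) (2 * p) x,
    fun p => hAr none p x, fun j p => ?_, hr0 none x, fun j => ?_,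
    ⟨gradedOp T (N x none), fun j => gradedOp T (N x (some j)),
      constantCoeff_gradedOp T (hN0 x none), fun j => constantCoeff_gradedOp T (hN0 x (some j))⟩,
    ⟨gradedOp S (N x none),
      fun j => MvPowerSeries.C (ω (cellIdx hkn σ j)) + gradedOp S (N x (some j))⟩, ?_, ?_⟩
  · simp only [map_add, MvPolynomial.eval_C, hAr]
  · simp only [if_true, mul_zero, hr0, add_zero]
  · have := transforms_of_solution hE hD hTS (hN x)
      ⟨gradedOp T (N x none), fun j => gradedOp T (N x (some j)),
        constantCoeff_gradedOp T (hN0 x none), fun j => constantCoeff_gradedOp T (hN0 x (some j))⟩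
      rfl fun j => rfl
    simpa only [hnone, hsome, leafReduction] using this
  · refine isNormalForm_of_onLeaf hk hkn σ c (hc.2.1 _).ne' _ _ _ (hrS none x) fun j => ?_
    rw [onLeaf_add, onLeaf_C, hrS]
    refine PowerSeries.ext fun m => ?_
    rw [map_add, PowerSeries.coeff_subst_X_pow two_ne_zero, PowerSeries.coeff_subst_X_pow
      two_ne_zero, PowerSeries.coeff_mk, PowerSeries.coeff_mk, PowerSeries.coeff_smul,
      PowerSeries.coeff_one]
    rcases Nat.eq_zero_or_pos m with rfl | hm
    · simp [Algebra.algebraMap_eq_smul_one, add_smul]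
    · rw [if_neg hm.ne', smul_zero, zero_add]
      split_ifs with h1 h2
      · omega
      · rw [zero_add]
      · rfl
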